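/- Let $\mathcal X$ be a finite alphabet, let $\{X_n\}_{n\in\mathbb Z}$ be a two-sided stationary and ergodic time series with values in $\mathcal X$, and let $g:\mathcal X\to\mathbb R$ be arbitrary. Write $X_m^n=(X_m,\dots,X_n)$ and $X_{-\infty}^0=(\dots,X_{-1},X_0)$. For $k\ge 1$ and $n\ge 0$ put $\tau^k_0(n)=0$ and, for $i\ge1$, $$\tau^k_i(n)=\min\{t>\tau^k_{i-1}(n): X_{n-k+1-t}^{n-t}=X_{n-k+1}^{n}\}$$ (with $\min\emptyset=\infty$). Let $$K_n=\max\bigl(1,\lfloor 0.1\log_{|\mathcal X|}n\rfloor\bigr),\qquad J_n=\max\bigl(1,\lceil n^{0.5}\rceil\bigr)\qquad(n\ge1)$$ (with $K_n=1$ if $|\mathcal X|=1$). Let $$\kappa_n=\max\{1\le k\le K_n:\ \tau^k_{J_n}(n)\le n-k+1\}$$ if there is such a $k$, and $\kappa_n=0$ otherwise; let $$\lambda_n=\max\{j\ge1:\ \tau^{\kappa_n}_j(n)\le n-\kappa_n+1\}$$ if $\kappa_n>0$, and $\lambda_n=0$ otherwise. Define the estimator by $g_0=0$ and, for $n\ge1$,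 $$g_n=\frac1{\lambda_n}\sum_{i=1}^{\lambda_n} g\bigl(X_{n-\tau^{\kappa_n}_i(n)+1}\bigr)$$ if $\kappa_n>0$, and $g_n=0$ otherwise. On the set $\mathcal X^{*-}$ of all one-sided sequences $(\dots,x_{-1},x_0)$ in $\mathcal X$ consider the metric $$d^*(x_{-\infty}^0,y_{-\infty}^0)=\sum_{i=0}^\infty 2^{-i-1}\mathbf 1_{\{x_{-i}\ne y_{-i}\}}.$$ Then: (A) If there is a function $G:\mathcal X^{*-}\to\mathbb R$, continuous on $\mathcal X^{*-}$ with respect to $d^*$, such that $G(X_{-\infty}^0)=E(g(X_1)\mid X_{-\infty}^0)$ almost surely, then $$\lim_{n\to\infty}\bigl|g_n-E(g(X_{n+1})\mid X_0^n)\bigr|=0\quad\text{almost surely.}$$ (B) Without any continuity assumption, $$\lim_{n\to\infty}\frac1n\sum_{i=0}^{n-1}\bigl|g_i-E(g(X_{i+1})\mid X_0^i)\bigr|=0\quad\text{almost surely.}$$ (C) Without any continuity assumption, for every $\epsilon>0$, $$\lim_{n\to\infty}P\bigl(\bigl|g_n-E(g(X_{n+1})\mid X_0^n)\bigr|>\epsilon\bigr)=0.$$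 -/

import Mathlib

open MeasureTheory Filter Topology

noncomputable section

namespace Forecast

/-- The left shift `(T x)_i = x_{i+1}` on two-sided sequences. -/
def shift {α : Type*} (x : ℤ → α) : ℤ → α := fun i => x (i + 1)

/-- The random two-sided sequence `(X_i(ω))_{i ∈ ℤ}`. -/
def path {Ω α : Type*} (X : ℤ → Ω → α) (ω : Ω) : ℤ → α := fun i => X i ω

/-- `X` is a stationary and ergodic two-sided time series: every `X i` is a random variable, and
the law of the whole sequence is invariant (`Ergodic` includes measure preservation) and ergodic
under the left shift. -/
def IsStationaryErgodic {Ω α : Type*} [MeasurableSpace Ω] [MeasurableSpace α]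
    (μ : Measure Ω) (X : ℤ → Ω → α) : Prop :=
  (∀ i, Measurable (X i)) ∧ Ergodic (shift (α := α)) (μ.map (path X))

/-- The σ-algebra generated by the variables `X i`, `i ∈ s`. -/
abbrev sigmaOf {Ω α : Type*} [MeasurableSpace α] (X : ℤ → Ω → α) (s : Set ℤ) : MeasurableSpace Ω :=
  MeasurableSpace.comap (fun ω (i : s) => X i ω) MeasurableSpace.pi

/-- `τ^k_i(n)`: `τ^k_0(n) = 0` and
`τ^k_{i+1}(n) = min {t > τ^k_i(n) : x_{n-k+1-t}^{n-t} = x_{n-k+1}^n}`, which is `⊤` if there is no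
such `t`. -/
def tau {α : Type*} (x : ℤ → α) (k n : ℕ) : ℕ → ℕ∞
  | 0 => 0
  | i + 1 => sInf ((fun t : ℕ => (t : ℕ∞)) '' {t : ℕ | tau x k n i < (t : ℕ∞) ∧
      ∀ j : ℤ, (n : ℤ) - k + 1 ≤ j → j ≤ n → x (j - t) = x j})

/-- `K_n = max(1, ⌊0.1 log_{|α|} n⌋)`. -/
def K (α : Type*) [Fintype α] (n : ℕ) : ℕ :=
  max 1 ⌊(0.1 : ℝ) * Real.logb (Fintype.card α) n⌋₊

/-- `J_n = max(1, ⌈n^{0.5}⌉)`. -/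
def J (n : ℕ) : ℕ := max 1 ⌈(n : ℝ) ^ (0.5 : ℝ)⌉₊

/-- `κ_n = max {1 ≤ k ≤ K_n : τ^k_{J_n}(n) ≤ n - k + 1}`, and `0` if there is no such `k`. -/
def kappa {α : Type*} [Fintype α] (x : ℤ → α) (n : ℕ) : ℕ :=
  sSup {k : ℕ | 1 ≤ k ∧ k ≤ K α n ∧ tau x k n (J n) + k ≤ n + 1}

open Classical in
/-- `λ_n = max {j ≥ 1 : τ^{κ_n}_j(n) ≤ n - κ_n + 1}` if `κ_n > 0`, and `0` otherwise. -/
def lam {α : Type*} [Fintype α] (x : ℤ → α) (n : ℕ) : ℕ :=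
  if 0 < kappa x n then
    sSup {j : ℕ | 1 ≤ j ∧ tau x (kappa x n) n j + kappa x n ≤ n + 1}
  else 0

open Classical in
/-- The estimator `g_n`, as a function of the realization `x`. -/
def estimator {α : Type*} [Fintype α] (g : α → ℝ) (x : ℤ → α) (n : ℕ) : ℝ :=
  if 1 ≤ n ∧ 0 < kappa x n then
    (1 / (lam x n : ℝ)) *
      ∑ i ∈ Finset.Icc 1 (lam x n), g (x ((n : ℤ) - (tau x (kappa x n) n i).toNat + 1))
  else 0

open Classical in
/-- The metric `d*` on one-sided pasts; the coordinate `x i` of `x : ℕ → α` stands for `x_{-i}`. -/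
def dStar {α : Type*} (x y : ℕ → α) : ℝ :=
  ∑' i : ℕ, (2 : ℝ)⁻¹ ^ (i + 1) * (if x i ≠ y i then 1 else 0)

/-- Some version `G` of `E(g(X_1) | X_{-∞}^0)`, a function on all one-sided pasts, is continuous
with respect to `d*`. -/
def HasContinuousVersion {Ω α : Type*} [MeasurableSpace Ω] [MeasurableSpace α]
    (μ : Measure Ω) (X : ℤ → Ω → α) (g : α → ℝ) : Prop :=
  ∃ G : (ℕ → α) → ℝ,
    (fun ω => G fun i => X (-(i : ℤ)) ω) =ᵐ[μ] μ[fun ω => g (X 1 ω) | sigmaOf X (Set.Iic 0)] ∧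
    ∀ x, ∀ ε > 0, ∃ δ > 0, ∀ y, dStar x y < δ → |G y - G x| < ε

/-- The error `|g_n - E(g(X_{n+1}) | X_0^n)|`. -/
def error {Ω α : Type*} [MeasurableSpace Ω] [MeasurableSpace α] [Fintype α]
    (μ : Measure Ω) (X : ℤ → Ω → α) (g : α → ℝ) (n : ℕ) (ω : Ω) : ℝ :=
  |estimator g (path X ω) n -
    (μ[fun ω' => g (X ((n : ℤ) + 1) ω') | sigmaOf X (Set.Icc 0 (n : ℤ))]) ω|

end Forecast

end

/-! When `kappa` is positive, the estimator is the average of g(X_{s+1}) over the earlier times s at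
which the current context ended (`estimator_eq`). Split g(X_{s+1}) into a martingale difference and
P(T^s X), where T is the shift and P the mean of g(X_1) given the whole past.

For a fixed word, the times at which it ends are selected predictably, so an exponential martingale
bound makes the average difference over at least J_n ≥ √n occurrences exceed ε with probability
O(exp(-δ J_n)). There are only polynomially many words of length at most K_n, so Borel–Cantelli
handles all admissible contexts at once (`exists_measureReal_deviationSet_le`). It remains to
compare the average of P(T^s X) with E(g(X_{n+1}) | X_0^n).

(A) Compactness makes G uniformly continuous, so P is nearly constant over times matching enough
letters, and means given long finite pasts are uniformly close to P. Words of positive probability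
recur linearly often while J_n is of order √n, so the context eventually becomes as long as needed.

(B), (C) Replace P by P_k, the mean given the last k + 1 letters, which is eventually constant over
the matches. The gap D_k = |P - P_k| has small integral by Lévy's theorem, but its average over the
matches of a rare word may be large. The covering inequality `mul_card_le_sum_of_window_average`
shows that, for one context length, at most (∑ D_k)/ε times are bad; K_m takes boundedly many values
on [ηN, N]. Times whose context of length K_m has fewer than J_m matches are o(N) by counting, and
at all others the context has length exactly K_m. The ergodic theorem, with Breiman's argument for
the gap |P - P_m| at T^m X, gives (B). For (C) the same counts are made over the shifts of one
realization and integrated, which needs stationarity only. Just the upper half of the ergodic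
theorem is used, applied to f or to -f. -/

namespace Forecast

/-! ### Recurrence times rewritten as sets of match times -/

section Matches

variable {α : Type*}

/-- The word of length `k` ending at time `n`, read backwards. -/
def word (x : ℤ → α) (k : ℕ) (n : ℤ) : Fin k → α := fun j => x (n - (j : ℕ))

open Classical in
/-- The backward distances `1 ≤ t ≤ L` at which the last `k` letters at time `n` reoccur. -/
noncomputable def recurrences (x : ℤ → α) (k n L : ℕ) : Finset ℕ :=
  {t ∈ Finset.Icc 1 L | word x k ((n : ℤ) - t) = word x k n}

open Classical in
/-- The times `s < n` at which the last `k` letters at time `n` occur inside `x_0, …, x_s`. -/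
noncomputable def matchTimes (x : ℤ → α) (k n : ℕ) : Finset ℕ :=
  {s ∈ Finset.range n | k ≤ s + 1 ∧ word x k s = word x k n}

lemma word_sub_eq_iff (x : ℤ → α) (k n t : ℕ) :
    word x k ((n : ℤ) - t) = word x k n ↔
      ∀ j : ℤ, (n : ℤ) - k + 1 ≤ j → j ≤ n → x (j - t) = x j := by
  constructor
  · intro h j h1 h2
    have := congrFun h ⟨((n : ℤ) - j).toNat, by omega⟩
    simp only [word] at this
    have e : ((((n : ℤ) - j).toNat : ℕ) : ℤ) = n - j := by omega
    rw [e] at this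
    convert this using 2 <;> ring
  · intro h
    funext j
    have := h ((n : ℤ) - (j : ℕ)) (by have := j.2; omega) (by omega)
    simp only [word]
    rw [← this]
    congr 1
    ring

lemma word_eq_apply {x : ℤ → α} {k : ℕ} {a b : ℤ} (h : word x k a = word x k b) {j : ℕ}
    (hj : j < k) : x (a - j) = x (b - j) := congrFun h ⟨j, hj⟩

lemma word_eq_of_le {x : ℤ → α} {k l : ℕ} {a b : ℤ} (h : word x l a = word x l b) (hkl : k ≤ l) :
    word x k a = word x k b := by
  funext j
  exact word_eq_apply h (j.2.trans_le hkl)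

lemma tau_succ_le_iff (x : ℤ → α) (k n i L : ℕ) :
    tau x k n (i + 1) ≤ L ↔ ∃ t : ℕ, t ≤ L ∧ tau x k n i < t ∧
      word x k ((n : ℤ) - t) = word x k n := by
  rw [tau]
  constructor
  · intro h
    set S := ((fun t : ℕ => (t : ℕ∞)) '' {t : ℕ | tau x k n i < (t : ℕ∞) ∧
      ∀ j : ℤ, (n : ℤ) - k + 1 ≤ j → j ≤ n → x (j - t) = x j}) with hS
    have hne : S.Nonempty := by
      by_contra hc
      rw [Set.not_nonempty_iff_eq_empty] at hc
      rw [hc, sInf_empty] at h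
      exact absurd h (by simp)
    obtain ⟨t, ht, hte⟩ := csInf_mem hne
    refine ⟨t, ?_, ht.1, (word_sub_eq_iff ..).2 ht.2⟩
    have : (t : ℕ∞) ≤ L := by simpa [hte] using h
    exact_mod_cast this
  · rintro ⟨t, htL, h1, h2⟩
    have ht : (t : ℕ∞) ∈ ((fun t : ℕ => (t : ℕ∞)) '' {t : ℕ | tau x k n i < (t : ℕ∞) ∧
      ∀ j : ℤ, (n : ℤ) - k + 1 ≤ j → j ≤ n → x (j - t) = x j}) :=
      Set.mem_image_of_mem _ (Set.mem_ofPred_eq ▸ ⟨h1, (word_sub_eq_iff ..).1 h2⟩)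
    exact (sInf_le ht).trans (by exact_mod_cast htL)

lemma tau_mem (x : ℤ → α) (k n i : ℕ) (h : tau x k n (i + 1) ≠ ⊤) :
    tau x k n i < tau x k n (i + 1) ∧
      word x k ((n : ℤ) - (tau x k n (i + 1)).toNat) = word x k n := by
  obtain ⟨t, ht⟩ := ENat.ne_top_iff_exists.1 h
  obtain ⟨s, hs, h1, h2⟩ := (tau_succ_le_iff x k n i t).1 ht.ge
  have : t ≤ s := by
    have := (tau_succ_le_iff x k n i s).2 ⟨s, le_rfl, h1, h2⟩
    rw [← ht] at this
    exact_mod_cast this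
  obtain rfl : s = t := le_antisymm hs this
  rw [← ht]
  exact ⟨h1, by simpa using h2⟩

/-- The `tau` values list the recurrences in increasing order. Counting those up to a finite bound
replaces the recursion in `ℕ∞` by cardinalities. -/
lemma tau_le_iff (x : ℤ → α) (k n i L : ℕ) :
    tau x k n i ≤ L ↔ i ≤ (recurrences x k n L).card := by
  classical
  induction i generalizing L with
  | zero => simp [tau]
  | succ i ih =>
    rw [tau_succ_le_iff]
    constructor
    · rintro ⟨t, htL, h1, h2⟩
      have ht0 : 0 < t := by
        rcases Nat.eq_zero_or_pos t with rfl | h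
        · simp at h1
        · exact h
      have h3 : i ≤ (recurrences x k n (t - 1)).card := by
        rw [← ih]
        obtain ⟨s, hs⟩ := ENat.ne_top_iff_exists.1 (ne_top_of_lt h1)
        rw [← hs] at h1 ⊢
        have : s < t := by exact_mod_cast h1
        have : s ≤ t - 1 := by omega
        exact_mod_cast this
      have h4 : insert t (recurrences x k n (t - 1)) ⊆ recurrences x k n L := by
        intro s hs
        simp only [recurrences, Finset.mem_insert, Finset.mem_filter, Finset.mem_Icc] at hs ⊢
        rcases hs with rfl | hs
        · exact ⟨⟨ht0, htL⟩, h2⟩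
        · exact ⟨⟨hs.1.1, by omega⟩, hs.2⟩
      have h5 := Finset.card_le_card h4
      rw [Finset.card_insert_of_notMem] at h5
      · omega
      · simp only [recurrences, Finset.mem_filter, Finset.mem_Icc]; omega
    · intro h
      have hne : (recurrences x k n L).Nonempty := Finset.card_pos.1 (by omega)
      set t := (recurrences x k n L).max' hne with ht
      have htm : t ∈ recurrences x k n L := Finset.max'_mem _ _
      have htm' := htm
      simp only [recurrences, Finset.mem_filter, Finset.mem_Icc] at htm
      refine ⟨t, htm.1.2, ?_, htm.2⟩
      have h4 : recurrences x k n L ⊆ insert t (recurrences x k n (t - 1)) := by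
        intro s hs
        have hst : s ≤ t := Finset.le_max' _ _ hs
        simp only [recurrences, Finset.mem_insert, Finset.mem_filter, Finset.mem_Icc] at hs ⊢
        rcases eq_or_lt_of_le hst with h | h
        · exact Or.inl h
        · exact Or.inr ⟨⟨hs.1.1, by omega⟩, hs.2⟩
      have h5 := (Finset.card_le_card h4).trans (Finset.card_insert_le _ _)
      have h6 : tau x k n i ≤ ((t - 1 : ℕ) : ℕ∞) := (ih _).2 (by omega)
      refine h6.trans_lt ?_
      have : t - 1 < t := by omega
      exact_mod_cast this

/-- Strict monotonicity makes `tau` injective on the first `c` indices; its image lies in a set of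
`c` elements, so it is a bijection. -/
lemma sum_tau (x : ℤ → α) (k n L : ℕ) (f : ℕ → ℝ) :
    ∑ i ∈ Finset.Icc 1 (recurrences x k n L).card, f (tau x k n i).toNat =
      ∑ t ∈ recurrences x k n L, f t := by
  classical
  set c := (recurrences x k n L).card with hc
  have hle : ∀ i, i ≤ c → tau x k n i ≤ L := fun i hi => (tau_le_iff ..).2 hi
  have hnt : ∀ i, i ≤ c → tau x k n i ≠ ⊤ := fun i hi =>
    ne_top_of_le_ne_top (ENat.natCast_ne_top L) (hle i hi)
  have hmono : ∀ j, j ≤ c → ∀ i, i < j → tau x k n i < tau x k n j := by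
    intro j
    induction j with
    | zero => intro _ i hi; omega
    | succ j ih =>
      intro hj i hi
      have h1 := (tau_mem x k n j (hnt _ hj)).1
      rcases Nat.lt_succ_iff_lt_or_eq.1 hi with h | rfl
      · exact (ih (by omega) i h).trans h1
      · exact h1
  have hinj : Set.InjOn (fun i => (tau x k n i).toNat) (Finset.Icc 1 c : Finset ℕ) := by
    intro i hi j hj hij
    simp only [Finset.coe_Icc, Set.mem_Icc] at hi hj
    have hij' : tau x k n i = tau x k n j := by
      rw [← ENat.natCast_toNat (hnt i hi.2), ← ENat.natCast_toNat (hnt j hj.2)]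
      exact_mod_cast hij
    rcases lt_trichotomy i j with h | h | h
    · exact absurd hij' (hmono j hj.2 i h).ne
    · exact h
    · exact absurd hij' (hmono i hi.2 j h).ne'
  have himg : (Finset.Icc 1 c).image (fun i => (tau x k n i).toNat) = recurrences x k n L := by
    apply Finset.eq_of_subset_of_card_le
    · intro t ht
      simp only [Finset.mem_image, Finset.mem_Icc] at ht
      obtain ⟨i, ⟨hi1, hic⟩, rfl⟩ := ht
      obtain ⟨i, rfl⟩ : ∃ j, i = j + 1 := ⟨i - 1, by omega⟩
      have h1 := tau_mem x k n i (hnt _ hic)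
      have h2 := hle _ hic
      obtain ⟨s, hs⟩ := ENat.ne_top_iff_exists.1 (hnt _ hic)
      rw [← hs] at h1 h2 ⊢
      simp only [recurrences, Finset.mem_filter, Finset.mem_Icc, ENat.toNat_natCast] at h1 h2 ⊢
      refine ⟨⟨?_, by exact_mod_cast h2⟩, h1.2⟩
      have h3 : (0 : ℕ∞) < s := (zero_le).trans_lt h1.1
      exact_mod_cast h3
    · rw [Finset.card_image_of_injOn hinj]; simp [hc]
  rw [← himg, Finset.sum_image hinj]

/-- Reflection t ↦ n - t. The bound t ≤ n + 1 - k is exactly the requirement that the matched word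
lie in nonnegative times. -/
lemma sum_recurrences (x : ℤ → α) {k n : ℕ} (hk : 1 ≤ k) (f : ℕ → ℝ) :
    ∑ t ∈ recurrences x k n (n + 1 - k), f (n - t) = ∑ s ∈ matchTimes x k n, f s := by
  classical
  refine Finset.sum_bij' (fun t _ => n - t) (fun s _ => n - s) ?_ ?_ ?_ ?_ ?_
  · intro t ht
    simp only [recurrences, matchTimes, Finset.mem_filter, Finset.mem_Icc, Finset.mem_range] at ht ⊢
    refine ⟨by omega, by omega, ?_⟩
    have : ((n - t : ℕ) : ℤ) = (n : ℤ) - t := by omega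
    rw [this]; exact ht.2
  · intro s hs
    simp only [recurrences, matchTimes, Finset.mem_filter, Finset.mem_Icc, Finset.mem_range] at hs ⊢
    refine ⟨by omega, ?_⟩
    have : (n : ℤ) - ((n - s : ℕ) : ℤ) = (s : ℤ) := by omega
    rw [this]; exact hs.2.2
  · intro t ht
    simp only [recurrences, Finset.mem_filter, Finset.mem_Icc] at ht
    omega
  · intro s hs
    simp only [matchTimes, Finset.mem_filter, Finset.mem_range] at hs
    omega
  · intro t _; rfl

lemma card_recurrences (x : ℤ → α) {k n : ℕ} (hk : 1 ≤ k) :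
    (recurrences x k n (n + 1 - k)).card = (matchTimes x k n).card := by
  have := sum_recurrences x (n := n) hk (fun _ => 1)
  simp only [Finset.sum_const, nsmul_eq_mul, mul_one] at this
  exact_mod_cast this

/-- The hypothesis 1 ≤ j matters when k > n + 1: the subtraction n + 1 - k then truncates to 0, and
both sides are false. -/
lemma tau_add_le_iff (x : ℤ → α) {k n j : ℕ} (hk : 1 ≤ k) (hj : 1 ≤ j) :
    tau x k n j + k ≤ n + 1 ↔ j ≤ (matchTimes x k n).card := by
  classical
  rw [← card_recurrences x hk, ← tau_le_iff]
  by_cases hkn : k ≤ n + 1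
  · constructor
    · intro h
      have hnt : tau x k n j ≠ ⊤ := by
        intro h'
        rw [h', top_add, top_le_iff] at h
        exact absurd h (by exact_mod_cast ENat.natCast_ne_top (n + 1))
      obtain ⟨s, hs⟩ := ENat.ne_top_iff_exists.1 hnt
      rw [← hs] at h ⊢
      have : s + k ≤ n + 1 := by exact_mod_cast h
      have : s ≤ n + 1 - k := by omega
      exact_mod_cast this
    · intro h
      obtain ⟨s, hs⟩ := ENat.ne_top_iff_exists.1 (ne_top_of_le_ne_top (ENat.natCast_ne_top _) h)
      rw [← hs] at h ⊢
      have : s ≤ n + 1 - k := by exact_mod_cast h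
      have : s + k ≤ n + 1 := by omega
      exact_mod_cast this
  · constructor
    · intro h
      have : (k : ℕ∞) ≤ n + 1 := le_add_self.trans h
      exact absurd (by exact_mod_cast this) hkn
    · intro h
      rw [tau_le_iff, card_recurrences x hk] at h
      have h0 : (matchTimes x k n).card = 0 := by
        rw [Finset.card_eq_zero, matchTimes, Finset.filter_eq_empty_iff]
        intro s hs
        simp only [Finset.mem_range] at hs
        omega
      omega

variable [Fintype α]

lemma one_le_J (n : ℕ) : 1 ≤ J n := le_max_left _ _

lemma one_le_K (n : ℕ) : 1 ≤ K α n := le_max_left _ _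

lemma kappa_eq (x : ℤ → α) (n : ℕ) :
    kappa x n = sSup {k : ℕ | 1 ≤ k ∧ k ≤ K α n ∧ J n ≤ (matchTimes x k n).card} := by
  rw [kappa]
  congr 1
  ext k
  simp only [Set.mem_ofPred_eq]
  constructor
  · rintro ⟨h1, h2, h3⟩; exact ⟨h1, h2, (tau_add_le_iff x h1 (one_le_J n)).1 h3⟩
  · rintro ⟨h1, h2, h3⟩; exact ⟨h1, h2, (tau_add_le_iff x h1 (one_le_J n)).2 h3⟩

lemma bddAbove_kappa_set (x : ℤ → α) (n : ℕ) :
    BddAbove {k : ℕ | 1 ≤ k ∧ k ≤ K α n ∧ J n ≤ (matchTimes x k n).card} :=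
  ⟨K α n, fun _ hk => hk.2.1⟩

lemma le_kappa (x : ℤ → α) {n k : ℕ} (h1 : 1 ≤ k) (h2 : k ≤ K α n)
    (h3 : J n ≤ (matchTimes x k n).card) : k ≤ kappa x n := by
  rw [kappa_eq]
  exact le_csSup (bddAbove_kappa_set x n) ⟨h1, h2, h3⟩

lemma kappa_spec (x : ℤ → α) {n : ℕ} (h : 0 < kappa x n) :
    kappa x n ≤ K α n ∧ J n ≤ (matchTimes x (kappa x n) n).card := by
  rw [kappa_eq] at h
  have hne : {k : ℕ | 1 ≤ k ∧ k ≤ K α n ∧ J n ≤ (matchTimes x k n).card}.Nonempty := by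
    by_contra hc
    rw [Set.not_nonempty_iff_eq_empty] at hc
    rw [hc] at h
    simp at h
  have := Nat.sSup_mem hne (bddAbove_kappa_set x n)
  rw [← kappa_eq] at this
  exact this.2

/-- For (B) and (C): off the scarce times the random context length becomes deterministic. -/
lemma kappa_eq_K (x : ℤ → α) {n : ℕ} (h : J n ≤ (matchTimes x (K α n) n).card) :
    kappa x n = K α n := by
  have h1 := le_kappa x (one_le_K n) le_rfl h
  exact le_antisymm (kappa_spec x ((one_le_K (α := α) n).trans h1)).1 h1

lemma lam_eq (x : ℤ → α) {n : ℕ} (h : 0 < kappa x n) :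
    lam x n = (matchTimes x (kappa x n) n).card := by
  rw [lam, if_pos h]
  have h1 : 1 ≤ (matchTimes x (kappa x n) n).card := (one_le_J n).trans (kappa_spec x h).2
  have : {j : ℕ | 1 ≤ j ∧ tau x (kappa x n) n j + kappa x n ≤ n + 1} =
      Set.Icc 1 (matchTimes x (kappa x n) n).card := by
    ext j
    simp only [Set.mem_ofPred_eq, Set.mem_Icc]
    exact and_congr_right fun hj => tau_add_le_iff x h hj
  rw [this, csSup_Icc h1]

lemma estimator_eq (g : α → ℝ) (x : ℤ → α) {n : ℕ} (h : 0 < kappa x n) :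
    estimator g x n = (1 / ((matchTimes x (kappa x n) n).card : ℝ)) *
      ∑ s ∈ matchTimes x (kappa x n) n, g (x ((s : ℤ) + 1)) := by
  have hJ := (one_le_J n).trans (kappa_spec x h).2
  -- A match time is smaller than n, so the clause 1 ≤ n in the definition of the estimator is
  -- automatic.
  have hn : 1 ≤ n := by
    obtain ⟨s, hs⟩ := Finset.card_pos.1 hJ
    simp only [matchTimes, Finset.mem_filter, Finset.mem_range] at hs
    omega
  rw [estimator, if_pos ⟨hn, h⟩, lam_eq x h, ← sum_recurrences x h, ← card_recurrences x h,
    sum_tau x (kappa x n) n (n + 1 - kappa x n) fun t => g (x ((n : ℤ) - t + 1))]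
  congr 1
  refine Finset.sum_congr rfl fun t ht => ?_
  simp only [recurrences, Finset.mem_filter, Finset.mem_Icc] at ht
  have : ((n - t : ℕ) : ℤ) = (n : ℤ) - t := by omega
  rw [this]

lemma abs_estimator_le {g : α → ℝ} {C : ℝ} (hg : ∀ a, |g a| ≤ C) (x : ℤ → α) (n : ℕ) :
    |estimator g x n| ≤ C := by
  have hC : 0 ≤ C := (abs_nonneg _).trans (hg (x 0))
  by_cases h : 0 < kappa x n
  · rw [estimator_eq g x h]
    have hc : (0 : ℝ) < ((matchTimes x (kappa x n) n).card : ℝ) := by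
      exact_mod_cast (one_le_J n).trans (kappa_spec x h).2
    rw [abs_mul, abs_of_pos (by positivity), one_div, inv_mul_le_iff₀ hc]
    refine (Finset.abs_sum_le_sum_abs _ _).trans ((Finset.sum_le_sum fun s _ => hg _).trans ?_)
    simp
  · rw [estimator, if_neg (by tauto)]
    simpa using hC

end Matches

/-! ### Covering and counting along the classes of a partition of the times -/

section Combinatorics

open Classical in
/-- A maximal inequality along the classes of a partition of the times: if each `m ∈ B` comes with
a window `[b m, m)` in which the average of `a` over the times of the class of `m` exceeds `ε`, then
`B` has at most `(∑ a) / ε` elements. -/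
lemma mul_card_le_sum_of_window_average {β : Type*} (c : ℕ → β) (a : ℕ → ℝ) (ha : ∀ s, 0 ≤ a s)
    {ε : ℝ} (hε : 0 ≤ ε) (b : ℕ → ℕ) (N : ℕ) (B : Finset ℕ) (hBN : ∀ m ∈ B, m ≤ N)
    (hB : ∀ m ∈ B, ε * ({s ∈ Finset.Ico (b m) m | c s = c m} : Finset ℕ).card <
      ∑ s ∈ Finset.Ico (b m) m with c s = c m, a s) :
    ε * B.card ≤ ∑ s ∈ Finset.range N, a s := by
  set I : ℕ → Finset ℕ := fun m => {s ∈ Finset.Ico (b m) m | c s = c m} with hI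
  -- The bound by the sum over the union of the windows is what survives the induction: the largest
  -- time is removed together with all times whose window could meet its own.
  have key : ∀ q : ℕ, ∀ B : Finset ℕ, B.card = q →
      (∀ m ∈ B, ε * (I m).card < ∑ s ∈ I m, a s) → ε * B.card ≤ ∑ s ∈ B.biUnion I, a s := by
    intro q
    induction q using Nat.strong_induction_on with
    | _ q ih =>
      intro B hq hB
      rcases B.eq_empty_or_nonempty with rfl | hne
      · simp
      set m := B.max' hne with hm
      have hmB : m ∈ B := Finset.max'_mem _ _
      have hIne : (I m).Nonempty := by
        rw [Finset.nonempty_iff_ne_empty]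
        intro h
        have := hB m hmB
        rw [h] at this
        simp at this
      set R : Finset ℕ := {m' ∈ B | c m' = c m ∧ ∃ s, b m ≤ s ∧ s < m' ∧ c s = c m} with hR
      have hmR : m ∈ R := by
        obtain ⟨s, hs⟩ := hIne
        simp only [hI, Finset.mem_filter, Finset.mem_Ico] at hs
        simp only [hR, Finset.mem_filter]
        exact ⟨hmB, by trivial, s, hs.1.1, hs.1.2, hs.2⟩
      have hRcard : R.card ≤ (I m).card := by
        -- Every member of `R` other than m lies in the window of m, but is not its first element,
        -- since some s of that window precedes it. Hence `R` is no larger than the window.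
        have hsub : R ⊆ insert m ((I m).erase ((I m).min' hIne)) := by
          intro m' hm'
          simp only [hR, Finset.mem_filter] at hm'
          obtain ⟨hm'B, hcm', s, hbs, hsm', hcs⟩ := hm'
          have hle : m' ≤ m := Finset.le_max' _ _ hm'B
          have hsI : s ∈ I m := by
            simp only [hI, Finset.mem_filter, Finset.mem_Ico]
            exact ⟨⟨hbs, hsm'.trans_le hle⟩, hcs⟩
          have hmin := Finset.min'_le _ _ hsI
          rw [Finset.mem_insert, Finset.mem_erase]
          rcases eq_or_lt_of_le hle with h | h
          · exact Or.inl h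
          · refine Or.inr ⟨by omega, ?_⟩
            simp only [hI, Finset.mem_filter, Finset.mem_Ico]
            exact ⟨⟨by omega, h⟩, hcm'⟩
        refine (Finset.card_le_card hsub).trans ((Finset.card_insert_le _ _).trans ?_)
        rw [Finset.card_erase_of_mem (Finset.min'_mem _ _)]
        have := Finset.card_pos.2 hIne
        omega
      have hRB : R ⊆ B := Finset.filter_subset _ _
      have hcard : (B \ R).card + R.card = B.card := Finset.card_sdiff_add_card_eq_card hRB
      have hRpos : 0 < R.card := Finset.card_pos.2 ⟨m, hmR⟩
      have hih := ih (B \ R).card (by omega) (B \ R) rfl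
        (fun m' hm' => hB m' (Finset.mem_sdiff.1 hm').1)
      -- A time s common to the window of m' and that of m would be a witness for m' ∈ `R`.
      have hdisj : Disjoint ((B \ R).biUnion I) (I m) := by
        rw [Finset.disjoint_left]
        intro s hs hsm
        rw [Finset.mem_biUnion] at hs
        obtain ⟨m', hm', hsm'⟩ := hs
        rw [Finset.mem_sdiff] at hm'
        refine hm'.2 ?_
        simp only [hI, Finset.mem_filter, Finset.mem_Ico] at hsm hsm'
        simp only [hR, Finset.mem_filter]
        exact ⟨hm'.1, hsm'.2.symm.trans hsm.2, s, hsm.1.1, hsm'.1.2, hsm.2⟩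
      have hsubU : (B \ R).biUnion I ∪ I m ⊆ B.biUnion I := by
        refine Finset.union_subset (Finset.biUnion_subset_biUnion_of_subset_left _
          Finset.sdiff_subset) (Finset.subset_biUnion_of_mem I hmB)
      calc ε * B.card = ε * (B \ R).card + ε * R.card := by
            rw [← hcard]; push_cast; ring
        _ ≤ ∑ s ∈ (B \ R).biUnion I, a s + ∑ s ∈ I m, a s := by
            refine add_le_add hih (le_trans ?_ (hB m hmB).le)
            exact mul_le_mul_of_nonneg_left (by exact_mod_cast hRcard) hε
        _ = ∑ s ∈ (B \ R).biUnion I ∪ I m, a s := (Finset.sum_union hdisj).symm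
        _ ≤ ∑ s ∈ B.biUnion I, a s :=
            Finset.sum_le_sum_of_subset_of_nonneg hsubU fun s _ _ => ha s
  refine (key _ B rfl hB).trans (Finset.sum_le_sum_of_subset_of_nonneg ?_ fun s _ _ => ha s)
  intro s hs
  rw [Finset.mem_biUnion] at hs
  obtain ⟨m, hm, hsm⟩ := hs
  simp only [hI, Finset.mem_filter, Finset.mem_Ico] at hsm
  exact Finset.mem_range.2 (hsm.1.2.trans_le (hBN m hm))

open Classical in
/-- At most `j` times of each class have fewer than `j` earlier times of the same class. -/
lemma card_le_of_few_visits {β : Type*} [Fintype β] (c : ℕ → β) (a j : ℕ) (B : Finset ℕ)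
    (hBa : ∀ m ∈ B, a ≤ m)
    (hB : ∀ m ∈ B, ({s ∈ Finset.Ico a m | c s = c m} : Finset ℕ).card < j) :
    B.card ≤ Fintype.card β * j := by
  have h : B.card ≤ j * (Finset.univ : Finset β).card := by
    refine Finset.card_le_mul_card_image_of_maps_to (f := c) (fun _ _ => Finset.mem_univ _) j ?_
    intro w _
    by_contra hlt
    push Not at hlt
    set F : Finset ℕ := {m ∈ B | c m = w} with hF
    have hne : F.Nonempty := Finset.card_pos.1 (by omega)
    have hm := Finset.max'_mem F hne
    -- The last member of an overfull class sees all the others among its earlier visits.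
    set m := F.max' hne with hmdef
    have hm' := hm
    simp only [hF, Finset.mem_filter] at hm
    have hsub : F.erase m ⊆ {s ∈ Finset.Ico a m | c s = c m} := by
      intro s hs
      rw [Finset.mem_erase] at hs
      have hle : s ≤ m := Finset.le_max' _ _ hs.2
      have hs2 := hs.2
      simp only [hF, Finset.mem_filter] at hs2
      simp only [Finset.mem_filter, Finset.mem_Ico]
      exact ⟨⟨hBa s hs2.1, lt_of_le_of_ne hle hs.1⟩, hs2.2.trans hm.2.symm⟩
    have h1 := Finset.card_le_card hsub
    rw [Finset.card_erase_of_mem hm'] at h1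
    have := hB m hm.1
    omega
  rwa [mul_comm] at h

end Combinatorics

/-! ### Growth of the maximal length and of the required number of matches -/

section Growth

variable (α : Type*) [Fintype α]

lemma K_mono : Monotone (K α) := by
  intro m n hmn
  unfold K
  refine max_le_max le_rfl (Nat.floor_le_floor ?_)
  refine mul_le_mul_of_nonneg_left ?_ (by norm_num)
  unfold Real.logb
  refine div_le_div_of_nonneg_right ?_ (Real.log_natCast_nonneg _)
  rcases Nat.eq_zero_or_pos m with rfl | hm
  · simpa using Real.log_natCast_nonneg n
  · exact Real.log_le_log (by exact_mod_cast hm) (by exact_mod_cast hmn)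

lemma J_mono : Monotone J := by
  intro m n hmn
  unfold J
  refine max_le_max le_rfl (Nat.ceil_le_ceil ?_)
  exact Real.rpow_le_rpow (by positivity) (by exact_mod_cast hmn) (by norm_num)

/-- Over times of comparable size the function `K` varies boundedly. -/
lemma exists_K_le_add {η : ℝ} (hη : 0 < η) :
    ∃ L : ℕ, ∀ N m : ℕ, η * N ≤ m → K α N ≤ K α m + L := by
  set d : ℝ := (0.1 : ℝ) * Real.logb (Fintype.card α) η⁻¹ with hd
  -- `d` bounds 0.1 log(N/m) and is negative if η > 1, hence the maximum; the added 1 absorbs the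
  -- fractional parts.
  refine ⟨⌊max d 0⌋₊ + 1, fun N m h => ?_⟩
  rcases Nat.eq_zero_or_pos N with rfl | hN
  · exact (K_mono α (Nat.zero_le m)).trans (Nat.le_add_right _ _)
  have hN' : (0 : ℝ) < N := by exact_mod_cast hN
  have hm' : (0 : ℝ) < m := (mul_pos hη hN').trans_le h
  have hlog : (0.1 : ℝ) * Real.logb (Fintype.card α) N ≤
      (0.1 : ℝ) * Real.logb (Fintype.card α) m + d := by
    rw [hd, ← mul_add]
    refine mul_le_mul_of_nonneg_left ?_ (by norm_num)
    unfold Real.logb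
    rw [← add_div]
    refine div_le_div_of_nonneg_right ?_ (Real.log_natCast_nonneg _)
    rw [← Real.log_mul hm'.ne' (inv_pos.2 hη).ne']
    refine Real.log_le_log hN' ?_
    rw [← div_eq_mul_inv, le_div_iff₀ hη, mul_comm]
    exact h
  have hnn : 0 ≤ (0.1 : ℝ) * Real.logb (Fintype.card α) m := by
    refine mul_nonneg (by norm_num) ?_
    unfold Real.logb
    exact div_nonneg (Real.log_natCast_nonneg _) (Real.log_natCast_nonneg _)
  unfold K
  have hfl : ⌊(0.1 : ℝ) * Real.logb (Fintype.card α) N⌋₊ ≤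
      ⌊(0.1 : ℝ) * Real.logb (Fintype.card α) m⌋₊ + (⌊max d 0⌋₊ + 1) := by
    rw [← Nat.lt_add_one_iff, Nat.floor_lt']
    · push_cast
      have h1 := Nat.lt_floor_add_one ((0.1 : ℝ) * Real.logb (Fintype.card α) m)
      have h2 := Nat.lt_floor_add_one (max d 0)
      have h3 := le_max_left d 0
      linarith
    · omega
  omega

variable {α}

/-- The factor 0.1 in K_n is what keeps the number of words of order n^0.1. The extra factor |α|
covers the case where the floor is 0 and K_n = 1. -/
lemma card_pow_K_le [Nonempty α] {n : ℕ} (hn : 1 ≤ n) :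
    (Fintype.card α : ℝ) ^ K α n ≤ Fintype.card α * (n : ℝ) ^ (0.1 : ℝ) := by
  have hc : 1 ≤ Fintype.card α := Fintype.card_pos
  have hc' : (1 : ℝ) ≤ Fintype.card α := by exact_mod_cast hc
  have hn' : (1 : ℝ) ≤ n := by exact_mod_cast hn
  have hr : (1 : ℝ) ≤ (n : ℝ) ^ (0.1 : ℝ) := Real.one_le_rpow hn' (by norm_num)
  rcases eq_or_lt_of_le hc with h1 | h1
  · rw [← h1]; simpa using hr
  have h1' : (1 : ℝ) < Fintype.card α := by exact_mod_cast h1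
  unfold K
  rcases le_total 1 ⌊(0.1 : ℝ) * Real.logb (Fintype.card α) n⌋₊ with h | h
  · rw [max_eq_right h]
    have hnn : 0 ≤ (0.1 : ℝ) * Real.logb (Fintype.card α) n :=
      mul_nonneg (by norm_num) (Real.logb_nonneg h1' hn')
    calc (Fintype.card α : ℝ) ^ ⌊(0.1 : ℝ) * Real.logb (Fintype.card α) n⌋₊
        = (Fintype.card α : ℝ) ^ ((⌊(0.1 : ℝ) * Real.logb (Fintype.card α) n⌋₊ : ℕ) : ℝ) :=
          (Real.rpow_natCast _ _).symm
      _ ≤ (Fintype.card α : ℝ) ^ ((0.1 : ℝ) * Real.logb (Fintype.card α) n) :=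
          Real.rpow_le_rpow_of_exponent_le hc' (Nat.floor_le hnn)
      _ = (n : ℝ) ^ (0.1 : ℝ) := by
          rw [mul_comm, Real.rpow_mul (by positivity),
            Real.rpow_logb (by positivity) h1'.ne' (by positivity)]
      _ ≤ Fintype.card α * (n : ℝ) ^ (0.1 : ℝ) := le_mul_of_one_le_left (by positivity) hc'
  · rw [max_eq_left h, pow_one]
    exact le_mul_of_one_le_right (by positivity) hr

lemma K_le [Nonempty α] {n : ℕ} (hn : 1 ≤ n) :
    (K α n : ℝ) ≤ Fintype.card α * (n : ℝ) ^ (0.1 : ℝ) := by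
  have hc : 1 ≤ Fintype.card α := Fintype.card_pos
  rcases eq_or_lt_of_le hc with h1 | h1
  · have hn' : (1 : ℝ) ≤ n := by exact_mod_cast hn
    have : K α n = 1 := by unfold K; rw [← h1]; simp
    rw [this, ← h1]
    simpa using Real.one_le_rpow hn' (by norm_num : (0 : ℝ) ≤ 0.1)
  · refine le_trans ?_ (card_pow_K_le hn)
    exact_mod_cast (Nat.lt_pow_self h1).le

lemma J_le {n : ℕ} (hn : 1 ≤ n) : (J n : ℝ) ≤ 2 * (n : ℝ) ^ (0.5 : ℝ) := by
  have hn' : (1 : ℝ) ≤ n := by exact_mod_cast hn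
  have hr : (1 : ℝ) ≤ (n : ℝ) ^ (0.5 : ℝ) := Real.one_le_rpow hn' (by norm_num)
  unfold J
  rw [Nat.cast_max, max_le_iff]
  have := Nat.ceil_lt_add_one (zero_le_one.trans hr)
  constructor
  · push_cast; linarith
  · linarith

lemma sqrt_le_J (n : ℕ) : Real.sqrt n ≤ J n := by
  unfold J
  rw [Nat.cast_max, Real.sqrt_eq_rpow]
  refine le_trans ?_ (le_max_right _ _)
  have h : (1 / 2 : ℝ) = 0.5 := by norm_num
  rw [h]
  exact Nat.le_ceil _

variable (α) in
-- For one letter the logarithm to base 1 is 0 by convention and K_n stays at 1, but then all words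
-- agree anyway.
lemma subsingleton_or_tendsto_K : Subsingleton α ∨ Tendsto (K α) atTop atTop := by
  rcases le_or_gt (Fintype.card α) 1 with h | h
  · exact Or.inl (Fintype.card_le_one_iff_subsingleton.1 h)
  · right
    have h' : (1 : ℝ) < Fintype.card α := by exact_mod_cast h
    unfold K
    refine tendsto_atTop_mono (fun n => le_max_right _ _) ?_
    refine tendsto_nat_floor_atTop.comp (Tendsto.const_mul_atTop (by norm_num) ?_)
    exact (Real.tendsto_logb_atTop h').comp tendsto_natCast_atTop_atTop

/-- Long matches force agreement of any fixed number of letters. -/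
lemma eventually_word_eq (k : ℕ) : ∀ᶠ n : ℕ in atTop, ∀ (x : ℤ → α) (a b : ℤ) (l : ℕ),
    min k (K α n) ≤ l → word x l a = word x l b → word x k a = word x k b := by
  rcases subsingleton_or_tendsto_K α with h | h
  · exact Eventually.of_forall fun n x a b l _ _ => funext fun j => Subsingleton.elim _ _
  · filter_upwards [h.eventually_ge_atTop k] with n hn x a b l hl hw
    exact word_eq_of_le hw (by omega)

/-- This quantity will bound the density of scarce times: K + 1 lengths, |α|^K words with fewer than
J visits each, and K initial times. It is O(n^(0.1 + 0.1 + 0.5) / n) = O(n^(-0.3)); in terms of r =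
n^0.1 all the estimates are polynomial. -/
lemma tendsto_rare_visits [Nonempty α] :
    Tendsto (fun n : ℕ => (((K α n + 1 : ℕ) : ℝ) * ((Fintype.card α : ℝ) ^ K α n * J n + K α n)) / n)
      atTop (𝓝 0) := by
  set A : ℝ := (Fintype.card α : ℝ) with hA
  have hA1 : 1 ≤ A := by
    have : 1 ≤ Fintype.card α := Fintype.card_pos
    rw [hA]; exact_mod_cast this
  have hlim : Tendsto (fun n : ℕ => (6 * A ^ 2) * (n : ℝ) ^ (-(0.3 : ℝ))) atTop (𝓝 0) := by
    have := ((tendsto_rpow_neg_atTop (by norm_num : (0 : ℝ) < 0.3)).comp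
      tendsto_natCast_atTop_atTop).const_mul (6 * A ^ 2)
    simpa using this
  refine squeeze_zero' (Eventually.of_forall fun n => by positivity) ?_ hlim
  filter_upwards [eventually_ge_atTop 1] with n hn
  have hn' : (1 : ℝ) ≤ n := by exact_mod_cast hn
  have hn0 : (0 : ℝ) < n := by linarith
  set r := (n : ℝ) ^ (0.1 : ℝ) with hr
  have hr1 : 1 ≤ r := Real.one_le_rpow hn' (by norm_num)
  have h1 : (K α n : ℝ) ≤ A * r := K_le hn
  have h2 : A ^ K α n ≤ A * r := card_pow_K_le hn
  have h3 : (J n : ℝ) ≤ 2 * r ^ 5 := by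
    refine (J_le hn).trans_eq ?_
    rw [hr, ← Real.rpow_natCast, ← Real.rpow_mul hn0.le]
    norm_num
  have h4 : (n : ℝ) ^ (-(0.3 : ℝ)) * n = r ^ 7 := by
    nth_rewrite 2 [← Real.rpow_one (n : ℝ)]
    rw [hr, ← Real.rpow_natCast, ← Real.rpow_mul hn0.le, ← Real.rpow_add hn0]
    norm_num
  rw [div_le_iff₀ hn0, mul_assoc, h4]
  have hAr : 1 ≤ A * r := by nlinarith
  have e1 : ((K α n + 1 : ℕ) : ℝ) ≤ 2 * (A * r) := by push_cast; linarith
  have hr5 : 1 ≤ r ^ 5 := one_le_pow₀ hr1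
  have e2 : A ^ K α n * J n + K α n ≤ (A * r) * (3 * r ^ 5) := by
    have : A ^ K α n * J n ≤ (A * r) * (2 * r ^ 5) := by gcongr
    nlinarith
  calc ((K α n + 1 : ℕ) : ℝ) * (A ^ K α n * J n + K α n)
      ≤ (2 * (A * r)) * ((A * r) * (3 * r ^ 5)) := by gcongr
    _ = 6 * A ^ 2 * r ^ 7 := by ring

lemma summable_words_mul_exp [Nonempty α] {δ : ℝ} (hδ : 0 < δ) :
    Summable fun n : ℕ => ((K α n + 1 : ℕ) : ℝ) *
      ((Fintype.card α : ℝ) ^ K α n * Real.exp (-δ * J n)) := by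
  set A : ℝ := (Fintype.card α : ℝ) with hA
  have hA1 : 1 ≤ A := by
    have : 1 ≤ Fintype.card α := Fintype.card_pos
    rw [hA]; exact_mod_cast this
  have hs : Summable fun n : ℕ => (2 * A ^ 2 * (720 / δ ^ 6)) * (1 / (n : ℝ) ^ 2) :=
    (Real.summable_one_div_nat_pow.2 (by norm_num)).mul_left _
  refine Summable.of_norm_bounded_eventually_nat hs ?_
  filter_upwards [eventually_ge_atTop 1] with n hn
  have hn' : (1 : ℝ) ≤ n := by exact_mod_cast hn
  have hn0 : (0 : ℝ) < n := by linarith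
  set r := (n : ℝ) ^ (0.1 : ℝ) with hr
  have hr1 : 1 ≤ r := Real.one_le_rpow hn' (by norm_num)
  have h1 : (K α n : ℝ) ≤ A * r := K_le hn
  have h2 : A ^ K α n ≤ A * r := card_pow_K_le hn
  have hAr : 1 ≤ A * r := by nlinarith
  have e1 : ((K α n + 1 : ℕ) : ℝ) ≤ 2 * (A * r) := by push_cast; linarith
  have hr2 : r ^ 2 ≤ n := by
    rw [hr, ← Real.rpow_natCast, ← Real.rpow_mul hn0.le]
    nth_rewrite 2 [← Real.rpow_one (n : ℝ)]
    exact Real.rpow_le_rpow_of_exponent_le hn' (by norm_num)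
  -- From u^6/6! ≤ exp u at u = δ√n. The decay n^(-3) leaves n^(-2) after the word count, which is
  -- at most a constant times r^2 ≤ n.
  have hexp : Real.exp (-δ * J n) ≤ 720 / δ ^ 6 * (1 / (n : ℝ) ^ 3) := by
    have h3 : Real.exp (-δ * J n) ≤ Real.exp (-(δ * Real.sqrt n)) := by
      apply Real.exp_le_exp.2
      have := mul_le_mul_of_nonneg_left (sqrt_le_J n) hδ.le
      linarith
    have h4 := Real.pow_div_factorial_le_exp (δ * Real.sqrt n) (by positivity) 6
    have h5 : (δ * Real.sqrt n) ^ 6 = δ ^ 6 * (n : ℝ) ^ 3 := by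
      have : Real.sqrt n ^ 6 = (n : ℝ) ^ 3 := by
        rw [show (6 : ℕ) = 2 * 3 by norm_num, pow_mul, Real.sq_sqrt hn0.le]
      rw [mul_pow, this]
    refine h3.trans ?_
    rw [Real.exp_neg, inv_le_comm₀ (Real.exp_pos _) (by positivity)]
    refine le_trans (le_of_eq ?_) h4
    rw [h5]
    simp only [Nat.factorial]
    field_simp
    norm_num
  rw [Real.norm_of_nonneg (by positivity)]
  calc ((K α n + 1 : ℕ) : ℝ) * (A ^ K α n * Real.exp (-δ * J n))
      ≤ (2 * (A * r)) * ((A * r) * (720 / δ ^ 6 * (1 / (n : ℝ) ^ 3))) := by gcongr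
    _ = (2 * A ^ 2 * (720 / δ ^ 6)) * (r ^ 2 * (1 / (n : ℝ) ^ 3)) := by ring
    _ ≤ (2 * A ^ 2 * (720 / δ ^ 6)) * (n * (1 / (n : ℝ) ^ 3)) := by gcongr
    _ = (2 * A ^ 2 * (720 / δ ^ 6)) * (1 / (n : ℝ) ^ 2) := by field_simp

end Growth

/-! ### The maximal ergodic inequality and the upper ergodic theorem -/

section Ergodic

variable {X : Type*} {T : X → X} {f : X → ℝ}

/-- The maximum of the Birkhoff sums of length at most `n` (the empty one included). -/
noncomputable def maxBirkhoffSum (T : X → X) (f : X → ℝ) : ℕ → X → ℝ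
  | 0 => 0
  | n + 1 => fun x => max 0 (f x + maxBirkhoffSum T f n (T x))

lemma maxBirkhoffSum_nonneg (n : ℕ) (x : X) : 0 ≤ maxBirkhoffSum T f n x := by
  cases n with
  | zero => exact le_rfl
  | succ n => exact le_max_left _ _

lemma maxBirkhoffSum_le_succ (n : ℕ) (x : X) :
    maxBirkhoffSum T f n x ≤ maxBirkhoffSum T f (n + 1) x := by
  induction n generalizing x with
  | zero => exact maxBirkhoffSum_nonneg 1 x
  | succ n ih => exact max_le_max le_rfl (by linarith [ih (T x)])

lemma birkhoffSum_le_maxBirkhoffSum (n : ℕ) (x : X) :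
    birkhoffSum T f n x ≤ maxBirkhoffSum T f n x := by
  induction n generalizing x with
  | zero => simp [maxBirkhoffSum]
  | succ n ih =>
    rw [birkhoffSum_succ']
    exact (by linarith [ih (T x)] : _ ≤ f x + maxBirkhoffSum T f n (T x)).trans (le_max_right _ _)

variable [MeasurableSpace X] {μ : Measure X}

lemma measurable_maxBirkhoffSum (hT : Measurable T) (hf : Measurable f) (n : ℕ) :
    Measurable (maxBirkhoffSum T f n) := by
  induction n with
  | zero => exact measurable_const
  | succ n ih => exact measurable_const.max (hf.add (ih.comp hT))

lemma integrable_maxBirkhoffSum (hT : MeasurePreserving T μ μ) (hf : Integrable f μ) (n : ℕ) :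
    Integrable (maxBirkhoffSum T f n) μ := by
  induction n with
  | zero => exact integrable_zero _ _ _
  | succ n ih =>
    exact (integrable_zero X ℝ μ).sup (hf.add (hT.integrable_comp_of_integrable ih))

/-- The maximal ergodic inequality. -/
lemma integral_indicator_maxBirkhoffSum_nonneg (hT : MeasurePreserving T μ μ) (hfm : Measurable f)
    (hf : Integrable f μ) (n : ℕ) :
    0 ≤ ∫ x, {x | 0 < maxBirkhoffSum T f n x}.indicator f x ∂μ := by
  have hM := integrable_maxBirkhoffSum hT hf n
  have hMT : Integrable (fun x => maxBirkhoffSum T f n (T x)) μ :=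
    hT.integrable_comp_of_integrable hM
  have hmeas : MeasurableSet {x | 0 < maxBirkhoffSum T f n x} :=
    measurableSet_lt measurable_const (measurable_maxBirkhoffSum hT.measurable hfm n)
  have h0 : ∫ x, (maxBirkhoffSum T f n x - maxBirkhoffSum T f n (T x)) ∂μ = 0 := by
    rw [integral_sub hM hMT, sub_eq_zero]
    conv_lhs => rw [← hT.map_eq]
    refine integral_map hT.measurable.aemeasurable ?_
    rw [hT.map_eq]
    exact hM.aestronglyMeasurable
  -- Write M_n for the maximum. Where M_n > 0, f = M_n - M_{n-1} ∘ T ≥ M_n - M_n ∘ T; elsewhere M_n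
  -- - M_n ∘ T ≤ 0. The difference M_n - M_n ∘ T has integral 0 by invariance.
  refine h0.symm.le.trans (integral_mono (hM.sub hMT) (hf.indicator hmeas) fun x => ?_)
  show maxBirkhoffSum T f n x - maxBirkhoffSum T f n (T x) ≤ _
  by_cases hx : 0 < maxBirkhoffSum T f n x
  · rw [Set.indicator_of_mem (show x ∈ {x | 0 < maxBirkhoffSum T f n x} from hx)]
    cases n with
    | zero => exact absurd hx (lt_irrefl _)
    | succ n =>
      have h1 : maxBirkhoffSum T f (n + 1) x = f x + maxBirkhoffSum T f n (T x) := by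
        rcases max_choice 0 (f x + maxBirkhoffSum T f n (T x)) with h | h
        · exact absurd (hx.trans_eq h) (lt_irrefl _)
        · exact h
      linarith [maxBirkhoffSum_le_succ (T := T) (f := f) n (T x)]
  · rw [Set.indicator_of_notMem (show x ∉ {x | 0 < maxBirkhoffSum T f n x} from hx)]
    linarith [maxBirkhoffSum_nonneg (T := T) (f := f) n (T x)]

/-- If almost every point has a positive Birkhoff sum, the integral is nonnegative. -/
lemma integral_nonneg_of_ae_birkhoffSum_pos (hT : MeasurePreserving T μ μ) (hfm : Measurable f)
    (hf : Integrable f μ) (h : ∀ᵐ x ∂μ, ∃ n, 0 < birkhoffSum T f n x) : 0 ≤ ∫ x, f x ∂μ := by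
  have hlim : Tendsto (fun n => ∫ x, {x | 0 < maxBirkhoffSum T f n x}.indicator f x ∂μ) atTop
      (𝓝 (∫ x, f x ∂μ)) := by
    refine tendsto_integral_of_dominated_convergence (fun x => ‖f x‖) (fun n => ?_) hf.norm
      (fun n => Eventually.of_forall fun x => norm_indicator_le_norm_self _ _) ?_
    · exact (hf.indicator (measurableSet_lt measurable_const
        (measurable_maxBirkhoffSum hT.measurable hfm n))).aestronglyMeasurable
    · filter_upwards [h] with x ⟨n, hn⟩
      refine tendsto_const_nhds.congr' ?_
      filter_upwards [eventually_ge_atTop n] with m hm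
      have : 0 < maxBirkhoffSum T f m x :=
        (hn.trans_le (birkhoffSum_le_maxBirkhoffSum n x)).trans_le
          (monotone_nat_of_le_succ (fun n => maxBirkhoffSum_le_succ (T := T) (f := f) n x) hm)
      exact (Set.indicator_of_mem (show x ∈ {x | 0 < maxBirkhoffSum T f m x} from this) f).symm
  exact ge_of_tendsto' hlim fun n => integral_indicator_maxBirkhoffSum_nonneg hT hfm hf n

/-- The upper half of the pointwise ergodic theorem. -/
theorem ae_exists_birkhoffSum_le [IsProbabilityMeasure μ] (hT : Ergodic T μ) (hfm : Measurable f)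
    (hf : Integrable f μ) {q : ℝ} (hq : ∫ x, f x ∂μ < q) :
    ∀ᵐ x ∂μ, ∃ R : ℝ, ∀ N : ℕ, ∑ i ∈ Finset.range N, f (T^[i] x) ≤ q * N + R := by
  set h : X → ℝ := fun x => f x - q with hh
  have hhm : Measurable h := hfm.sub measurable_const
  have hhi : Integrable h μ := hf.sub (integrable_const q)
  have hmp := hT.toMeasurePreserving
  have hsum : ∀ N x, birkhoffSum T h N x = ∑ i ∈ Finset.range N, f (T^[i] x) - q * N := by
    intro N x
    simp [birkhoffSum, hh, Finset.sum_sub_distrib, mul_comm]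
  have hmeasN : ∀ N, Measurable (birkhoffSum T h N) := by
    intro N
    unfold birkhoffSum
    exact Finset.measurable_fun_sum _ fun i _ => hhm.comp (hT.measurable.iterate i)
  -- Unboundedness above of the Birkhoff sums of f - q is a shift-invariant event. If it had full
  -- measure, the maximal inequality would give ∫ (f - q) ≥ 0.
  set A : Set X := {x | ∀ R : ℕ, ∃ N, (R : ℝ) < birkhoffSum T h N x} with hA
  have hAm : MeasurableSet A := by
    have : A = ⋂ R : ℕ, ⋃ N, {x | (R : ℝ) < birkhoffSum T h N x} := by
      ext x; simp [hA]
    rw [this]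
    exact MeasurableSet.iInter fun R => MeasurableSet.iUnion fun N =>
      measurableSet_lt measurable_const (hmeasN N)
  have hAinv : T ⁻¹' A = A := by
    ext x
    constructor
    · intro hx R
      obtain ⟨N, hN⟩ := hx ⌈(R : ℝ) - h x⌉₊
      refine ⟨N + 1, ?_⟩
      rw [birkhoffSum_succ']
      have := Nat.le_ceil ((R : ℝ) - h x)
      linarith
    · intro hx R
      -- A threshold of at least 0 excludes the empty sum, so a first term can be split off.
      obtain ⟨N, hN⟩ := hx ⌈max 0 ((R : ℝ) + h x)⌉₊
      have h1 := Nat.le_ceil (max 0 ((R : ℝ) + h x))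
      have h2 := le_max_left 0 ((R : ℝ) + h x)
      have h3 := le_max_right 0 ((R : ℝ) + h x)
      cases N with
      | zero => simp only [birkhoffSum_zero] at hN; linarith
      | succ N =>
        rw [birkhoffSum_succ'] at hN
        exact ⟨N, by linarith⟩
  rcases hT.toPreErgodic.ae_empty_or_univ hAm hAinv with h0 | h1
  · have : ∀ᵐ x ∂μ, x ∉ A := by
      have := ae_eq_empty.1 h0
      exact measure_eq_zero_iff_ae_notMem.1 this
    filter_upwards [this] with x hx
    simp only [hA, Set.mem_ofPred_eq, not_forall, not_exists, not_lt] at hx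
    obtain ⟨R, hR⟩ := hx
    refine ⟨R, fun N => ?_⟩
    have := hR N
    rw [hsum] at this
    linarith
  · exfalso
    have : ∀ᵐ x ∂μ, ∃ n, 0 < birkhoffSum T h n x := by
      have h2 : ∀ᵐ x ∂μ, x ∈ A := by
        filter_upwards [h1] with x hx
        have : (x ∈ A) = (x ∈ Set.univ) := hx
        rw [this]; trivial
      filter_upwards [h2] with x hx
      simpa using hx 0
    have := integral_nonneg_of_ae_birkhoffSum_pos hmp hhm hhi this
    rw [hh, integral_sub hf (integrable_const q)] at this
    simp at this
    linarith

end Ergodic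

/-! ### Pull-back of conditional expectations and an exponential martingale bound -/

section CondExp

/-- Conditional expectations commute with pull-back along a map to the image space. -/
lemma condExp_comp_comap {Ω Y : Type*} {m : MeasurableSpace Y} [mΩ : MeasurableSpace Ω]
    [mY : MeasurableSpace Y] {μ : Measure Ω} [IsFiniteMeasure μ] {φ : Ω → Y} (hφ : Measurable φ)
    (hm : m ≤ mY) {f : Y → ℝ} (hf : Integrable f (μ.map φ)) :
    μ[fun ω => f (φ ω) | m.comap φ] =ᵐ[μ] fun ω => ((μ.map φ)[f | m]) (φ ω) := by
  have hle : m.comap φ ≤ mΩ := (MeasurableSpace.comap_mono hm).trans hφ.comap_le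
  have hci : Integrable ((μ.map φ)[f | m]) (μ.map φ) := integrable_condExp
  have hint : Integrable (fun ω => ((μ.map φ)[f | m]) (φ ω)) μ :=
    (integrable_map_measure hci.aestronglyMeasurable hφ.aemeasurable).1 hci
  have hfi : Integrable (fun ω => f (φ ω)) μ :=
    (integrable_map_measure hf.aestronglyMeasurable hφ.aemeasurable).1 hf
  symm
  refine ae_eq_condExp_of_forall_setIntegral_eq hle hfi (fun s _ _ => hint.integrableOn) ?_ ?_
  · rintro s ⟨t, ht, rfl⟩ -
    have htY : MeasurableSet t := hm t ht
    rw [← setIntegral_map htY hci.aestronglyMeasurable hφ.aemeasurable,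
      ← setIntegral_map htY hf.aestronglyMeasurable hφ.aemeasurable]
    exact setIntegral_condExp hm hf ht
  · have h1 : StronglyMeasurable[m] ((μ.map φ)[f | m]) := stronglyMeasurable_condExp
    have h2 : Measurable[m.comap φ, m] φ := comap_measurable φ
    exact (h1.comp_measurable h2).aestronglyMeasurable

/-- An exponential moment bound for sums of bounded martingale differences with predictable
`0`-`1` weights, normalized by the number of nonzero weights. -/
lemma integral_exp_martingale_le_one {Ω : Type*} [mΩ : MeasurableSpace Ω] {μ : Measure Ω}
    [IsProbabilityMeasure μ] (ℱ : ℕ → MeasurableSpace Ω) (hmono : Monotone ℱ) (hle : ∀ n, ℱ n ≤ mΩ)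
    (c Y : ℕ → Ω → ℝ) (hc : ∀ n, StronglyMeasurable[ℱ n] (c n))
    (hc01 : ∀ n ω, c n ω = 0 ∨ c n ω = 1)
    (hY : ∀ n, StronglyMeasurable[ℱ (n + 1)] (Y n)) {C θ : ℝ} (hYC : ∀ n ω, |Y n ω| ≤ C)
    (hθ : |θ| * (2 * C) ≤ 1) (n : ℕ) :
    ∫ ω, Real.exp (∑ s ∈ Finset.range n, (θ * (c s ω * (Y s ω - (μ[Y s | ℱ s]) ω)) -
      (θ * (2 * C)) ^ 2 * c s ω)) ∂μ ≤ 1 := by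
  set h : ℕ → Ω → ℝ := fun s => μ[Y s | ℱ s] with hh
  set b : ℝ := (θ * (2 * C)) ^ 2 with hb
  have hb0 : 0 ≤ b := sq_nonneg _
  set W : ℕ → Ω → ℝ := fun n ω => Real.exp (∑ s ∈ Finset.range n,
    (θ * (c s ω * (Y s ω - h s ω)) - b * c s ω)) with hW
  have hZ : ∀ s, ∀ᵐ ω ∂μ, |Y s ω - h s ω| ≤ 2 * C := by
    intro s
    have h1 : ∀ᵐ ω ∂μ, |h s ω| ≤ C :=
      ae_bdd_abs_condExp_of_ae_bdd_abs (Eventually.of_forall (hYC s))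
    filter_upwards [h1] with ω hω
    have := abs_sub (Y s ω) (h s ω)
    linarith [hYC s ω]
  have hY' : ∀ s, StronglyMeasurable (Y s) := fun s => (hY s).mono (hle _)
  have hYi : ∀ s, Integrable (Y s) μ := fun s =>
    Integrable.of_bound (hY' s).aestronglyMeasurable C (Eventually.of_forall (hYC s))
  have hWm : ∀ n, StronglyMeasurable[ℱ n] (W n) := by
    intro n
    refine Real.continuous_exp.comp_stronglyMeasurable ?_
    refine Finset.stronglyMeasurable_fun_sum _ fun s hs => ?_
    have hs' : s + 1 ≤ n := Finset.mem_range.1 hs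
    have m1 : StronglyMeasurable[ℱ n] (c s) := (hc s).mono (hmono (by omega))
    have m2 : StronglyMeasurable[ℱ n] (Y s) := (hY s).mono (hmono hs')
    have m3 : StronglyMeasurable[ℱ n] (h s) := stronglyMeasurable_condExp.mono (hmono (by omega))
    exact ((m1.mul (m2.sub m3)).const_mul θ).sub (m1.const_mul b)
  have hterm : ∀ s, ∀ᵐ ω ∂μ, |θ * (c s ω * (Y s ω - h s ω))| ≤ 1 := by
    intro s
    filter_upwards [hZ s] with ω hω
    rcases hc01 s ω with h0 | h1
    · simp [h0]
    · rw [h1, one_mul, abs_mul]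
      exact (mul_le_mul_of_nonneg_left hω (abs_nonneg _)).trans hθ
  have hc0 : ∀ s ω, 0 ≤ c s ω := fun s ω => by rcases hc01 s ω with h | h <;> simp [h]
  have hc1 : ∀ s ω, c s ω ≤ 1 := fun s ω => by rcases hc01 s ω with h | h <;> simp [h]
  -- A crude bound, needed only for integrability.
  have hWb : ∀ n, ∀ᵐ ω ∂μ, W n ω ≤ Real.exp n := by
    intro n
    filter_upwards [ae_all_iff.2 hterm] with ω hω
    refine Real.exp_le_exp.2 ?_
    calc ∑ s ∈ Finset.range n, (θ * (c s ω * (Y s ω - h s ω)) - b * c s ω)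
        ≤ ∑ s ∈ Finset.range n, (1 : ℝ) := Finset.sum_le_sum fun s _ => by
          have := mul_nonneg hb0 (hc0 s ω)
          linarith [(abs_le.1 (hω s)).2]
      _ = n := by simp
  have hWi : ∀ n, Integrable (W n) μ := fun n =>
    Integrable.of_bound ((hWm n).mono (hle n)).aestronglyMeasurable (Real.exp n) (by
      filter_upwards [hWb n] with ω hω
      rwa [Real.norm_of_nonneg (Real.exp_pos _).le])
  change ∫ ω, W n ω ∂μ ≤ 1
  induction n with
  | zero => simp [hW]
  | succ n ih =>
    refine le_trans ?_ ih
    -- `V` is known at time n, so `V` times the martingale difference has integral 0. The pointwise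
    -- bound W_{n+1} ≤ W_n + θ V (Y_n - h_n) then makes ∫ W_n nonincreasing.
    set V : Ω → ℝ := fun ω => W n ω * Real.exp (-(b * c n ω)) * c n ω with hV
    have hVm : StronglyMeasurable[ℱ n] V :=
      ((hWm n).mul (Real.continuous_exp.comp_stronglyMeasurable ((hc n).const_mul b).neg)).mul (hc n)
    have hVb : ∀ᵐ ω ∂μ, ‖V ω‖ ≤ Real.exp n := by
      filter_upwards [hWb n] with ω hω
      have h1 : Real.exp (-(b * c n ω)) ≤ 1 := by
        rw [Real.exp_le_one_iff]
        linarith [mul_nonneg hb0 (hc0 n ω)]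
      have hw : 0 < W n ω := Real.exp_pos _
      rw [Real.norm_of_nonneg (by have := hc0 n ω; positivity)]
      calc W n ω * Real.exp (-(b * c n ω)) * c n ω ≤ W n ω * 1 * 1 := by
            have := hc0 n ω
            have := hc1 n ω
            gcongr
        _ ≤ Real.exp n := by simpa using hω
    have hVY : Integrable (fun ω => V ω * Y n ω) μ :=
      (hYi n).bdd_mul (hVm.mono (hle n)).aestronglyMeasurable hVb
    have hVh : Integrable (fun ω => V ω * h n ω) μ :=
      integrable_condExp.bdd_mul (hVm.mono (hle n)).aestronglyMeasurable hVb
    have hzero : ∫ ω, V ω * (Y n ω - h n ω) ∂μ = 0 := by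
      simp only [mul_sub]
      rw [integral_sub hVY hVh, sub_eq_zero]
      have h1 : μ[V * Y n | ℱ n] =ᵐ[μ] V * h n :=
        condExp_mul_of_stronglyMeasurable_left hVm hVY (hYi n)
      have h2 := integral_condExp (hle n) (μ := μ) (f := V * Y n)
      rw [integral_congr_ae h1] at h2
      exact h2.symm
    have hVZ : Integrable (fun ω => θ * (V ω * (Y n ω - h n ω))) μ := by
      simp only [mul_sub]
      exact (hVY.const_mul θ).sub (hVh.const_mul θ)
    calc ∫ ω, W (n + 1) ω ∂μ ≤ ∫ ω, (W n ω + θ * (V ω * (Y n ω - h n ω))) ∂μ := by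
          refine integral_mono_ae (hWi _) ((hWi n).add hVZ) ?_
          filter_upwards [hterm n, hZ n] with ω h1 h2
          set y := θ * (c n ω * (Y n ω - h n ω)) with hy
          have hw : 0 < W n ω := Real.exp_pos _
          have e1 : W (n + 1) ω = W n ω * (Real.exp (-(b * c n ω)) * Real.exp y) := by
            simp only [hW]
            rw [Finset.sum_range_succ, Real.exp_add, ← Real.exp_add (-(b * c n ω))]
            congr 2
            ring
          -- exp y ≤ 1 + y + y² for |y| ≤ 1, and y² ≤ b c because c is 0 or 1. The compensator
          -- exp(-b c) then absorbs 1 + b c.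
          have e2 : Real.exp y ≤ 1 + y + b * c n ω := by
            have := (abs_le.1 (Real.abs_exp_sub_one_sub_id_le h1)).2
            have h3 : y ^ 2 ≤ b * c n ω := by
              rcases hc01 n ω with h0 | h0
              · simp [hy, h0]
              · rw [hy, h0, hb, one_mul, mul_one, mul_pow, mul_pow]
                exact mul_le_mul_of_nonneg_left (sq_le_sq' (abs_le.1 h2).1 (abs_le.1 h2).2)
                  (sq_nonneg _)
            linarith
          have e3 : Real.exp (-(b * c n ω)) * (1 + b * c n ω) ≤ 1 := by
            rw [Real.exp_neg, inv_mul_le_iff₀ (Real.exp_pos _), mul_one]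
            linarith [Real.add_one_le_exp (b * c n ω)]
          show W (n + 1) ω ≤ W n ω + θ * (V ω * (Y n ω - h n ω))
          calc W (n + 1) ω ≤ W n ω * (Real.exp (-(b * c n ω)) * (1 + y + b * c n ω)) := by
                rw [e1]
                gcongr
            _ = W n ω * (Real.exp (-(b * c n ω)) * (1 + b * c n ω)) +
                  θ * (V ω * (Y n ω - h n ω)) := by
                rw [hy, hV]; ring
            _ ≤ W n ω + θ * (V ω * (Y n ω - h n ω)) := by
                have := mul_le_mul_of_nonneg_left e3 hw.le
                linarith
      _ = ∫ ω, W n ω ∂μ := by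
          rw [integral_add (hWi n) hVZ, integral_const_mul, hzero]
          simp

/-- A law-of-large-numbers tail bound for martingale differences sampled by predictable `0`-`1`
weights, on the event that at least `j` weights are nonzero. -/
lemma measureReal_weighted_martingale_le {Ω : Type*} [mΩ : MeasurableSpace Ω] {μ : Measure Ω}
    [IsProbabilityMeasure μ] (ℱ : ℕ → MeasurableSpace Ω) (hmono : Monotone ℱ) (hle : ∀ n, ℱ n ≤ mΩ)
    (c Y : ℕ → Ω → ℝ) (hc : ∀ n, StronglyMeasurable[ℱ n] (c n))
    (hc01 : ∀ n ω, c n ω = 0 ∨ c n ω = 1)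
    (hY : ∀ n, StronglyMeasurable[ℱ (n + 1)] (Y n)) {C θ ε : ℝ} (hYC : ∀ n ω, |Y n ω| ≤ C)
    (hθ0 : 0 < θ) (hθ : θ * (2 * C) ≤ 1) (hε : 2 * (θ * (2 * C) ^ 2) ≤ ε) (n j : ℕ) :
    μ.real {ω | (j : ℝ) ≤ ∑ s ∈ Finset.range n, c s ω ∧ ε * ∑ s ∈ Finset.range n, c s ω <
        |∑ s ∈ Finset.range n, c s ω * (Y s ω - (μ[Y s | ℱ s]) ω)|} ≤
      2 * Real.exp (-(θ * ε / 2) * j) := by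
  have hε0 : 0 ≤ ε := le_trans (by positivity) hε
  set h : ℕ → Ω → ℝ := fun s => μ[Y s | ℱ s] with hh
  set S : ℝ → Ω → ℝ := fun t ω => Real.exp (∑ s ∈ Finset.range n,
    (t * (c s ω * (Y s ω - h s ω)) - (t * (2 * C)) ^ 2 * c s ω)) with hS
  have hSm : ∀ t, Measurable (S t) := by
    intro t
    refine Real.measurable_exp.comp (Finset.measurable_fun_sum _ fun s _ => ?_)
    have m1 : Measurable (c s) := ((hc s).mono (hle s)).measurable
    have m2 : Measurable (Y s) := ((hY s).mono (hle _)).measurable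
    have m3 : Measurable (h s) := (stronglyMeasurable_condExp.mono (hle s)).measurable
    exact ((m1.mul (m2.sub m3)).const_mul t).sub (m1.const_mul _)
  have htail : ∀ t, |t| = θ → μ.real {ω | Real.exp ((θ * ε / 2) * j) ≤ S t ω} ≤
      Real.exp (-(θ * ε / 2) * j) := by
    intro t ht
    have h1 := integral_exp_martingale_le_one (μ := μ) ℱ hmono hle c Y hc hc01 hY hYC
      (θ := t) (by rw [ht]; exact hθ) n
    have hi : Integrable (S t) μ := by
      refine Integrable.of_bound (hSm t).aestronglyMeasurable (Real.exp n) ?_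
      have hb : ∀ s, ∀ᵐ ω ∂μ, |h s ω| ≤ C := fun s =>
        ae_bdd_abs_condExp_of_ae_bdd_abs (Eventually.of_forall (hYC s))
      filter_upwards [ae_all_iff.2 hb] with ω hω
      rw [Real.norm_of_nonneg (Real.exp_pos _).le]
      refine Real.exp_le_exp.2 ?_
      calc ∑ s ∈ Finset.range n, (t * (c s ω * (Y s ω - h s ω)) - (t * (2 * C)) ^ 2 * c s ω)
          ≤ ∑ s ∈ Finset.range n, (1 : ℝ) := Finset.sum_le_sum fun s _ => by
            rcases hc01 s ω with h0 | h0
            · simp [h0]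
            · rw [h0]
              have e1 := abs_sub (Y s ω) (h s ω)
              have e2 : |t * (1 * (Y s ω - h s ω))| ≤ 1 := by
                rw [one_mul, abs_mul, ht]
                refine le_trans (mul_le_mul_of_nonneg_left ?_ hθ0.le) hθ
                linarith [hYC s ω, hω s]
              have e3 := sq_nonneg (t * (2 * C))
              linarith [(abs_le.1 e2).2]
        _ = n := by simp
    have h2 := mul_meas_ge_le_integral_of_nonneg
      (Eventually.of_forall fun ω => (Real.exp_pos _).le : 0 ≤ᵐ[μ] S t) hi
      (Real.exp ((θ * ε / 2) * j))
    have h3 : Real.exp (-(θ * ε / 2) * j) = (Real.exp ((θ * ε / 2) * j))⁻¹ := by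
      rw [← Real.exp_neg]; congr 1; ring
    rw [h3, ← one_div, le_div_iff₀ (Real.exp_pos _), mul_comm]
    exact h2.trans h1
  have hsub : {ω | (j : ℝ) ≤ ∑ s ∈ Finset.range n, c s ω ∧ ε * ∑ s ∈ Finset.range n, c s ω <
        |∑ s ∈ Finset.range n, c s ω * (Y s ω - h s ω)|} ⊆
      {ω | Real.exp ((θ * ε / 2) * j) ≤ S θ ω} ∪ {ω | Real.exp ((θ * ε / 2) * j) ≤ S (-θ) ω} := by
    rintro ω ⟨h1, h2⟩
    set M := ∑ s ∈ Finset.range n, c s ω with hM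
    set Z := ∑ s ∈ Finset.range n, c s ω * (Y s ω - h s ω) with hZ
    have hSt : ∀ t, S t ω = Real.exp (t * Z - (t * (2 * C)) ^ 2 * M) := by
      intro t
      simp only [hS]
      rw [Finset.sum_sub_distrib, ← Finset.mul_sum, ← Finset.mul_sum]
    have hM0 : 0 ≤ M := le_trans (by positivity) h1
    -- By `hε` the quadratic compensator costs at most half of θεM, and M ≥ j. The two signs of t
    -- cover the two signs of Z.
    have key : θ * ε / 2 * j ≤ θ * |Z| - (θ * (2 * C)) ^ 2 * M := by
      have a1 : θ * ε / 2 * j ≤ θ * ε / 2 * M := mul_le_mul_of_nonneg_left h1 (by positivity)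
      have a2 : θ * (ε * M) ≤ θ * |Z| := mul_le_mul_of_nonneg_left h2.le hθ0.le
      have a3 : (θ * M) * (2 * (θ * (2 * C) ^ 2)) ≤ (θ * M) * ε :=
        mul_le_mul_of_nonneg_left hε (by positivity)
      nlinarith
    rcases abs_choice Z with hz | hz
    · left
      show _ ≤ S θ ω
      rw [hSt, Real.exp_le_exp, ← hz]
      exact key
    · right
      show _ ≤ S (-θ) ω
      rw [hSt, Real.exp_le_exp]
      rw [hz] at key
      refine key.trans_eq ?_
      ring
  calc _ ≤ μ.real ({ω | Real.exp ((θ * ε / 2) * j) ≤ S θ ω} ∪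
        {ω | Real.exp ((θ * ε / 2) * j) ≤ S (-θ) ω}) := measureReal_mono hsub
    _ ≤ _ := measureReal_union_le _ _
    _ ≤ 2 * Real.exp (-(θ * ε / 2) * j) := by
        have e1 := htail θ (abs_of_pos hθ0)
        have e2 := htail (-θ) (by rw [abs_neg, abs_of_pos hθ0])
        linarith

end CondExp

/-! ### The coordinate process, its conditional means and the shift -/

section Canonical

variable {α : Type*}

/-- The coordinate process on the space of two-sided sequences. -/
def coord (i : ℤ) (x : ℤ → α) : α := x i

@[simp] lemma coord_apply (i : ℤ) (x : ℤ → α) : coord i x = x i := rfl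

lemma path_coord (x : ℤ → α) : path coord x = x := rfl

lemma shift_iterate_apply (n : ℕ) (x : ℤ → α) (i : ℤ) : (shift^[n] x) i = x (i + n) := by
  induction n generalizing x with
  | zero => simp
  | succ n ih =>
    rw [Function.iterate_succ_apply, ih]
    simp only [shift]
    congr 1
    push_cast
    ring

lemma word_shift_iterate (x : ℤ → α) (k a : ℕ) (i : ℤ) :
    word (shift^[a] x) k i = word x k (i + a) := by
  funext j
  simp only [word, shift_iterate_apply]
  congr 1
  ring

variable [MeasurableSpace α]

lemma measurable_shift : Measurable (shift (α := α)) :=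
  measurable_pi_lambda _ fun i => measurable_pi_apply (i + 1)

lemma measurable_coord (i : ℤ) : Measurable (coord (α := α) i) := measurable_pi_apply i

lemma sigmaOf_eq_iSup {Ω : Type*} (X : ℤ → Ω → α) (s : Set ℤ) :
    sigmaOf X s = ⨆ i : s, MeasurableSpace.comap (X i) inferInstance := by
  simp only [sigmaOf, MeasurableSpace.pi, MeasurableSpace.comap_iSup, MeasurableSpace.comap_comp]
  rfl

lemma comap_le_sigmaOf {Ω : Type*} (X : ℤ → Ω → α) {s : Set ℤ} {i : ℤ} (hi : i ∈ s) :
    MeasurableSpace.comap (X i) inferInstance ≤ sigmaOf X s := by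
  rw [sigmaOf_eq_iSup]
  exact le_iSup (fun i : s => MeasurableSpace.comap (X i) inferInstance) ⟨i, hi⟩

lemma sigmaOf_mono {Ω : Type*} (X : ℤ → Ω → α) {s t : Set ℤ} (h : s ⊆ t) :
    sigmaOf X s ≤ sigmaOf X t := by
  rw [sigmaOf_eq_iSup X s]
  exact iSup_le fun i => comap_le_sigmaOf X (h i.2)

lemma sigmaOf_le {Ω : Type*} [mΩ : MeasurableSpace Ω] {X : ℤ → Ω → α} (hX : ∀ i, Measurable (X i))
    (s : Set ℤ) : sigmaOf X s ≤ mΩ := by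
  rw [sigmaOf_eq_iSup]
  exact iSup_le fun i => (hX i).comap_le

lemma sigmaOf_coord_le (s : Set ℤ) :
    sigmaOf (coord (α := α)) s ≤ (inferInstance : MeasurableSpace (ℤ → α)) :=
  sigmaOf_le measurable_coord s

lemma measurable_sigmaOf {Ω : Type*} (X : ℤ → Ω → α) {s : Set ℤ} {i : ℤ} (hi : i ∈ s) :
    Measurable[sigmaOf X s] (X i) :=
  measurable_iff_comap_le.2 (comap_le_sigmaOf X hi)

lemma comap_path_sigmaOf {Ω : Type*} (X : ℤ → Ω → α) (s : Set ℤ) :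
    (sigmaOf coord s).comap (path X) = sigmaOf X s := by
  simp only [sigmaOf, MeasurableSpace.comap_comp]
  rfl

lemma comap_shift_sigmaOf (n : ℕ) (s t : Set ℤ) (h : ∀ i, i ∈ s ↔ i + n ∈ t) :
    (sigmaOf (coord (α := α)) s).comap shift^[n] = sigmaOf coord t := by
  rw [sigmaOf_eq_iSup, sigmaOf_eq_iSup]
  simp only [MeasurableSpace.comap_iSup, MeasurableSpace.comap_comp]
  have e : ∀ i : ℤ, coord (α := α) i ∘ shift^[n] = coord (i + n) := fun i =>
    funext fun x => shift_iterate_apply n x i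
  simp only [e]
  apply le_antisymm
  · exact iSup_le fun i => le_iSup
      (fun i : t => MeasurableSpace.comap (coord (α := α) i) inferInstance) ⟨_, (h i).1 i.2⟩
  · refine iSup_le fun i => ?_
    have hi : (i : ℤ) - n ∈ s := (h _).2 (by simp)
    have := le_iSup (fun i : s => MeasurableSpace.comap (coord (α := α) (i + n)) inferInstance)
      ⟨_, hi⟩
    simpa using this

lemma iSup_sigmaOf_Icc :
    ⨆ m : ℕ, sigmaOf (coord (α := α)) (Set.Icc (-(m : ℤ)) 0) = sigmaOf coord (Set.Iic 0) := by
  apply le_antisymm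
  · exact iSup_le fun m => sigmaOf_mono _ fun i hi => hi.2
  · rw [sigmaOf_eq_iSup coord (Set.Iic 0)]
    refine iSup_le fun i => ?_
    refine le_trans ?_ (le_iSup _ ((-(i : ℤ)).toNat))
    have hi : (i : ℤ) ≤ 0 := i.2
    exact comap_le_sigmaOf _ ⟨by omega, i.2⟩

lemma measurable_word (k : ℕ) (i : ℤ) : Measurable fun x : ℤ → α => word x k i :=
  measurable_pi_lambda _ fun _ => measurable_pi_apply _

/-- `E(g(X_1) | X_{-∞}^0)` for the coordinate process. -/
noncomputable def pastMean (ν : Measure (ℤ → α)) (g : α → ℝ) : (ℤ → α) → ℝ :=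
  ν[fun x => g (x 1) | sigmaOf coord (Set.Iic 0)]

/-- `E(g(X_1) | X_{-m}^0)` for the coordinate process. -/
noncomputable def recentMean (ν : Measure (ℤ → α)) (g : α → ℝ) (m : ℕ) : (ℤ → α) → ℝ :=
  ν[fun x => g (x 1) | sigmaOf coord (Set.Icc (-(m : ℤ)) 0)]

variable {ν : Measure (ℤ → α)} (g : α → ℝ)

lemma measurable_pastMean : Measurable (pastMean ν g) :=
  (stronglyMeasurable_condExp.mono (sigmaOf_coord_le _)).measurable

lemma measurable_recentMean (m : ℕ) : Measurable (recentMean ν g m) :=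
  (stronglyMeasurable_condExp.mono (sigmaOf_coord_le _)).measurable

/-- The chosen version is measurable for the σ-algebra of the last m + 1 coordinates, so it factors
through them at every point, with no exceptional null set. -/
lemma recentMean_eq_of_word_eq {m : ℕ} {x y : ℤ → α}
    (h : word x (m + 1) 0 = word y (m + 1) 0) : recentMean ν g m x = recentMean ν g m y := by
  have hs : StronglyMeasurable[sigmaOf coord (Set.Icc (-(m : ℤ)) 0)] (recentMean ν g m) :=
    stronglyMeasurable_condExp
  refine (hs.factorsThrough) ?_
  funext i
  obtain ⟨i, hi1, hi2⟩ := i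
  have := congrFun h ⟨(-i).toNat, by omega⟩
  simp only [word] at this
  have e : (0 : ℤ) - (((-i).toNat : ℕ) : ℤ) = i := by omega
  rwa [e] at this

variable {g} in
lemma ae_abs_pastMean_le {C : ℝ} (hg : ∀ a, |g a| ≤ C) : ∀ᵐ x ∂ν, |pastMean ν g x| ≤ C :=
  ae_bdd_abs_condExp_of_ae_bdd_abs (Eventually.of_forall fun x => hg (x 1))

variable {g} in
lemma ae_abs_recentMean_le {C : ℝ} (hg : ∀ a, |g a| ≤ C) (m : ℕ) :
    ∀ᵐ x ∂ν, |recentMean ν g m x| ≤ C :=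
  ae_bdd_abs_condExp_of_ae_bdd_abs (Eventually.of_forall fun x => hg (x 1))

lemma ae_all_shift (hT : MeasurePreserving shift ν ν) {p : (ℤ → α) → Prop} (h : ∀ᵐ x ∂ν, p x) :
    ∀ᵐ x ∂ν, ∀ n : ℕ, p (shift^[n] x) :=
  ae_all_iff.2 fun n => (hT.iterate n).quasiMeasurePreserving.ae h

variable [IsProbabilityMeasure ν]

/-- Lévy's upward theorem: the finite pasts generate the whole past. -/
lemma ae_tendsto_recentMean :
    ∀ᵐ x ∂ν, Tendsto (fun m => recentMean ν g m x) atTop (𝓝 (pastMean ν g x)) := by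
  let ℱ : Filtration ℕ (inferInstance : MeasurableSpace (ℤ → α)) :=
    { seq := fun m => sigmaOf coord (Set.Icc (-(m : ℤ)) 0)
      mono' := fun m n hmn => sigmaOf_mono _ (Set.Icc_subset_Icc (by omega) le_rfl)
      le' := fun m => sigmaOf_coord_le _ }
  have h := tendsto_ae_condExp (μ := ν) (ℱ := ℱ) (fun x : ℤ → α => g (x 1))
  have e : ⨆ n, ℱ n = sigmaOf coord (Set.Iic 0) := iSup_sigmaOf_Icc
  rw [e] at h
  exact h

variable [Fintype α] [MeasurableSingletonClass α]

lemma measurableSet_word_eq (k : ℕ) (i j : ℤ) :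
    MeasurableSet {x : ℤ → α | word x k i = word x k j} :=
  measurableSet_eq_fun (measurable_word k i) (measurable_word k j)

lemma measurable_sum_matchTimes (k n : ℕ) {f : ℕ → (ℤ → α) → ℝ} (hf : ∀ s, Measurable (f s)) :
    Measurable fun x : ℤ → α => ∑ s ∈ matchTimes x k n, f s x := by
  classical
  have : (fun x : ℤ → α => ∑ s ∈ matchTimes x k n, f s x) = fun x => ∑ s ∈ Finset.range n,
      if k ≤ s + 1 ∧ word x k s = word x k n then f s x else 0 := by
    funext x
    simp only [matchTimes, Finset.sum_filter]
  rw [this]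
  refine Finset.measurable_fun_sum _ fun s _ => Measurable.ite ?_ (hf s) measurable_const
  by_cases h : k ≤ s + 1
  · simpa [h] using measurableSet_word_eq k s n
  · simp [h]

lemma measurable_card_matchTimes (k n : ℕ) :
    Measurable fun x : ℤ → α => ((matchTimes x k n).card : ℝ) := by
  have := measurable_sum_matchTimes (α := α) k n (f := fun _ _ => 1) fun _ => measurable_const
  simpa using this

lemma integrable_comp_coord (i : ℤ) : Integrable (fun x : ℤ → α => g (x i)) ν :=
  (Integrable.of_finite (μ := ν.map (fun x : ℤ → α => x i)) (f := g)).comp_measurable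
    (measurable_pi_apply i)

/-- Stationarity brings predictions at time n back to time 0, so one fixed function evaluated along
the orbit gives the conditional means at all times. -/
lemma condExp_shift (hT : MeasurePreserving shift ν ν) (n : ℕ) (s t : Set ℤ)
    (h : ∀ i, i ∈ s ↔ i + n ∈ t) :
    ν[fun x => g (x ((n : ℤ) + 1)) | sigmaOf coord t] =ᵐ[ν]
      fun x => (ν[fun x => g (x 1) | sigmaOf coord s]) (shift^[n] x) := by
  have hTn := hT.iterate n
  have h1 := condExp_comp_comap (μ := ν) (φ := shift^[n]) hTn.measurable
    (sigmaOf_coord_le (α := α) s) (f := fun x => g (x 1))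
    (by rw [hTn.map_eq]; exact integrable_comp_coord g 1)
  rw [hTn.map_eq, comap_shift_sigmaOf n s t h] at h1
  simpa only [shift_iterate_apply, add_comm] using h1

lemma condExp_Iic_eq (hT : MeasurePreserving shift ν ν) (n : ℕ) :
    ν[fun x => g (x ((n : ℤ) + 1)) | sigmaOf coord (Set.Iic (n : ℤ))] =ᵐ[ν]
      fun x => pastMean ν g (shift^[n] x) :=
  condExp_shift g hT n _ _ fun i => by simp

lemma condExp_Icc_eq (hT : MeasurePreserving shift ν ν) (n : ℕ) :
    ν[fun x => g (x ((n : ℤ) + 1)) | sigmaOf coord (Set.Icc 0 (n : ℤ))] =ᵐ[ν]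
      fun x => recentMean ν g n (shift^[n] x) :=
  condExp_shift g hT n _ _ fun i => by simp only [Set.mem_Icc]; omega

lemma ae_error_eq (hT : MeasurePreserving shift ν ν) :
    ∀ᵐ x ∂ν, ∀ n : ℕ, error ν coord g n x =
      |estimator g x n - recentMean ν g n (shift^[n] x)| := by
  refine ae_all_iff.2 fun n => ?_
  filter_upwards [condExp_Icc_eq g hT n] with x hx
  rw [error, path_coord]
  simp only [coord_apply]
  rw [hx]

end Canonical

/-! ### Counting scarce times and times with a large average -/

section Counting

variable {α : Type*}

open Classical in
lemma matchTimes_eq_filter_Ico (x : ℤ → α) {k : ℕ} (hk : 1 ≤ k) (n : ℕ) :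
    matchTimes x k n = {s ∈ Finset.Ico (k - 1) n | word x k (s : ℕ) = word x k n} := by
  ext s
  simp only [matchTimes, Finset.mem_filter, Finset.mem_range, Finset.mem_Ico]
  constructor
  · rintro ⟨h1, h2, h3⟩; exact ⟨⟨by omega, h1⟩, h3⟩
  · rintro ⟨⟨h1, h2⟩, h3⟩; exact ⟨h2, by omega, h3⟩

open Classical in
-- In absolute time, the matches of a shifted realization fill a window that starts at a + k - 1 and
-- so moves with a. This is why the covering inequality allows variable windows.
lemma sum_matchTimes_shift (x : ℤ → α) {k : ℕ} (hk : 1 ≤ k) (n a : ℕ) (f : ℕ → ℝ) :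
    ∑ s ∈ matchTimes (shift^[a] x) k n, f (s + a) =
      ∑ s ∈ Finset.Ico (a + (k - 1)) (n + a) with word x k (s : ℕ) = word x k ((n + a : ℕ) : ℤ),
        f s := by
  rw [matchTimes_eq_filter_Ico _ hk]
  refine Finset.sum_bij' (fun s _ => s + a) (fun s _ => s - a) ?_ ?_ ?_ ?_ ?_
  · intro s hs
    simp only [Finset.mem_filter, Finset.mem_Ico, word_shift_iterate] at hs ⊢
    push_cast
    exact ⟨⟨by omega, by omega⟩, hs.2⟩
  · intro s hs
    simp only [Finset.mem_filter, Finset.mem_Ico, word_shift_iterate] at hs ⊢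
    have e : ((s - a : ℕ) : ℤ) + a = s := by omega
    rw [e]
    have h2 := hs.2
    push_cast at h2
    exact ⟨⟨by omega, by omega⟩, h2⟩
  · intro s _; simp
  · intro s hs
    simp only [Finset.mem_filter, Finset.mem_Ico] at hs
    omega
  · intro s _; rfl

open Classical in
lemma card_matchTimes_shift (x : ℤ → α) {k : ℕ} (hk : 1 ≤ k) (n a : ℕ) :
    (matchTimes (shift^[a] x) k n).card =
      ({s ∈ Finset.Ico (a + (k - 1)) (n + a) |
        word x k (s : ℕ) = word x k ((n + a : ℕ) : ℤ)} : Finset ℕ).card := by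
  have := sum_matchTimes_shift x hk n a fun _ => 1
  simp only [Finset.sum_const, nsmul_eq_mul, mul_one] at this
  exact_mod_cast this

variable [Fintype α]

/-- The realizations for which the longest admissible word at time `n` has few occurrences. -/
def scarceSet (α : Type*) [Fintype α] (n : ℕ) : Set (ℤ → α) :=
  {x | (matchTimes x (K α n) n).card < J n}

/-- The realizations for which the average of `D` over the occurrences of the longest admissible
word at time `n` exceeds `ε`. -/
def largeAverageSet (D : (ℤ → α) → ℝ) (ε : ℝ) (n : ℕ) : Set (ℤ → α) :=
  {x | ε * (matchTimes x (K α n) n).card < ∑ s ∈ matchTimes x (K α n) n, D (shift^[s] x)}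

lemma card_words_le [Nonempty α] {k l : ℕ} (h : k ≤ l) :
    Fintype.card (Fin k → α) ≤ Fintype.card α ^ l := by
  rw [Fintype.card_fun, Fintype.card_fin]
  exact Nat.pow_le_pow_right Fintype.card_pos h

open Classical in
-- Times are grouped by the value of K_m; within a group, each word accounts for at most J_N scarce
-- times. The last summand covers the times too early for the word to fit.
lemma card_scarce_le [Nonempty α] (x : ℤ → α) (N : ℕ) :
    ({m ∈ Finset.range N | x ∈ scarceSet α m} : Finset ℕ).card ≤
      (K α N + 1) * (Fintype.card α ^ K α N * J N + K α N) := by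
  have h := Finset.card_le_mul_card_image_of_maps_to (f := fun m => K α m)
    (s := {m ∈ Finset.range N | x ∈ scarceSet α m}) (t := Finset.range (K α N + 1)) (fun m hm => by
      simp only [Finset.mem_filter, Finset.mem_range] at hm ⊢
      have := K_mono α hm.1.le
      omega) (Fintype.card α ^ K α N * J N + K α N) (by
    intro k hk
    rw [Finset.mem_range] at hk
    set B : Finset ℕ := {m ∈ Finset.range N | x ∈ scarceSet α m ∧ K α m = k ∧ k - 1 ≤ m} with hB
    have hsub : ({m ∈ {m ∈ Finset.range N | x ∈ scarceSet α m} | K α m = k} : Finset ℕ) ⊆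
        B ∪ Finset.range k := by
      intro m hm
      simp only [hB, Finset.mem_filter, Finset.mem_range, Finset.mem_union] at hm ⊢
      by_cases h : k - 1 ≤ m
      · exact Or.inl ⟨hm.1.1, hm.1.2, hm.2, h⟩
      · right; omega
    have hBcard : B.card ≤ Fintype.card (Fin k → α) * J N := by
      refine card_le_of_few_visits (fun m : ℕ => word x k m) (k - 1) (J N) B ?_ ?_
      · intro m hm
        simp only [hB, Finset.mem_filter] at hm
        exact hm.2.2.2
      · intro m hm
        simp only [hB, Finset.mem_filter, Finset.mem_range] at hm
        obtain ⟨hmN, hs, hK, -⟩ := hm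
        have hk1 : 1 ≤ k := hK ▸ one_le_K m
        have hs' : (matchTimes x (K α m) m).card < J m := hs
        rw [hK, matchTimes_eq_filter_Ico x hk1] at hs'
        refine lt_of_eq_of_lt ?_ (hs'.trans_le (J_mono hmN.le))
        congr!
    refine (Finset.card_le_card hsub).trans ((Finset.card_union_le _ _).trans ?_)
    rw [Finset.card_range]
    have := Nat.mul_le_mul_right (J N) (card_words_le (α := α) (show k ≤ K α N by omega))
    omega)
  rwa [Finset.card_range, mul_comm] at h

open Classical in
lemma card_scarce_shift_le [Nonempty α] (x : ℤ → α) (n : ℕ) :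
    ({a ∈ Finset.range n | shift^[a] x ∈ scarceSet α n} : Finset ℕ).card ≤
      Fintype.card α ^ K α n * J n + K α n := by
  set k := K α n with hk
  have hk1 : 1 ≤ k := one_le_K n
  set A : Finset ℕ := {a ∈ Finset.range n | shift^[a] x ∈ scarceSet α n ∧ k - 1 ≤ a} with hA
  have hsub : ({a ∈ Finset.range n | shift^[a] x ∈ scarceSet α n} : Finset ℕ) ⊆
      A ∪ Finset.range k := by
    intro m hm
    simp only [hA, Finset.mem_filter, Finset.mem_range, Finset.mem_union] at hm ⊢
    by_cases h : k - 1 ≤ m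
    · exact Or.inl ⟨hm.1, hm.2, h⟩
    · right; omega
  have hAcard : (A.map (addLeftEmbedding n)).card ≤ Fintype.card (Fin k → α) * J n := by
    refine card_le_of_few_visits (fun m : ℕ => word x k m) (n + (k - 1)) (J n) _ ?_ ?_
    · intro m hm
      simp only [hA, Finset.mem_map, Finset.mem_filter, addLeftEmbedding_apply] at hm
      omega
    · intro m hm
      simp only [hA, Finset.mem_map, Finset.mem_filter, Finset.mem_range,
        addLeftEmbedding_apply] at hm
      obtain ⟨a, ⟨han, hs, -⟩, rfl⟩ := hm
      have hs' : (matchTimes (shift^[a] x) k n).card < J n := hs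
      rw [card_matchTimes_shift x hk1] at hs'
      -- Since a < n, the common window start n + k - 1 lies to the right of a + k - 1, so fewer
      -- visits are counted.
      refine lt_of_le_of_lt (Finset.card_le_card fun s hs => ?_) hs'
      simp only [Finset.mem_filter, Finset.mem_Ico] at hs ⊢
      exact ⟨⟨by omega, hs.1.2⟩, hs.2⟩
  rw [Finset.card_map] at hAcard
  refine (Finset.card_le_card hsub).trans ((Finset.card_union_le _ _).trans ?_)
  rw [Finset.card_range]
  have := Nat.mul_le_mul_right (J n) (card_words_le (α := α) (le_refl k))
  omega

open Classical in
lemma mul_card_largeAverage_level_le (x : ℤ → α) {D : (ℤ → α) → ℝ} (hD : ∀ x, 0 ≤ D x) {ε : ℝ}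
    (hε : 0 ≤ ε) (N k : ℕ) :
    ε * ({m ∈ Finset.range N | x ∈ largeAverageSet D ε m ∧ K α m = k} : Finset ℕ).card ≤
      ∑ s ∈ Finset.range N, D (shift^[s] x) := by
  refine mul_card_le_sum_of_window_average (fun m : ℕ => word x k m) (fun s => D (shift^[s] x))
    (fun s => hD _) hε (fun _ => k - 1) N _ (fun m hm => ?_) fun m hm => ?_
  · exact (Finset.mem_range.1 (Finset.mem_filter.1 hm).1).le
  · obtain ⟨-, hm, hK⟩ := Finset.mem_filter.1 hm
    have hk1 : 1 ≤ k := hK ▸ one_le_K m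
    have hm' : ε * (matchTimes x (K α m) m).card <
      ∑ s ∈ matchTimes x (K α m) m, D (shift^[s] x) := hm
    rw [hK, matchTimes_eq_filter_Ico x hk1] at hm'
    convert hm'

open Classical in
-- The covering inequality handles one context length. Times before ηN are given up; on the others
-- K_m takes at most L + 1 values, each costing one sum of `D`.
lemma mul_card_largeAverage_le {η : ℝ} (hη : 0 < η) {ε : ℝ} (hε : 0 ≤ ε) {L : ℕ}
    (hL : ∀ N m : ℕ, η * N ≤ m → K α N ≤ K α m + L) (x : ℤ → α) {D : (ℤ → α) → ℝ}
    (hD : ∀ x, 0 ≤ D x) (N : ℕ) :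
    ε * ({m ∈ Finset.range N | x ∈ largeAverageSet D ε m} : Finset ℕ).card ≤
      ε * (η * N + 1) + (L + 1) * ∑ s ∈ Finset.range N, D (shift^[s] x) := by
  set M := ⌈η * N⌉₊ with hM
  have hηN : 0 ≤ η * N := by positivity
  set B : ℕ → Finset ℕ :=
    fun k => {m ∈ Finset.range N | x ∈ largeAverageSet D ε m ∧ K α m = k} with hB
  have hsub : ({m ∈ Finset.range N | x ∈ largeAverageSet D ε m} : Finset ℕ) ⊆
      Finset.range M ∪ (Finset.Icc (K α N - L) (K α N)).biUnion B := by
    intro m hm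
    simp only [Finset.mem_union, Finset.mem_biUnion, hB, Finset.mem_filter, Finset.mem_range,
      Finset.mem_Icc] at hm ⊢
    by_cases h : m < M
    · exact Or.inl h
    · right
      refine ⟨K α m, ⟨?_, K_mono α hm.1.le⟩, hm.1, hm.2, rfl⟩
      have : η * N ≤ m := (Nat.le_ceil _).trans (by exact_mod_cast not_lt.1 h)
      have := hL N m this
      omega
  have h1 : (({m ∈ Finset.range N | x ∈ largeAverageSet D ε m} : Finset ℕ).card : ℝ) ≤
      M + ∑ k ∈ Finset.Icc (K α N - L) (K α N), ((B k).card : ℝ) := by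
    have := (Finset.card_le_card hsub).trans ((Finset.card_union_le _ _).trans
      (Nat.add_le_add_left Finset.card_biUnion_le _))
    rw [Finset.card_range] at this
    exact_mod_cast this
  have hS : 0 ≤ ∑ s ∈ Finset.range N, D (shift^[s] x) := Finset.sum_nonneg fun s _ => hD _
  calc ε * (({m ∈ Finset.range N | x ∈ largeAverageSet D ε m} : Finset ℕ).card : ℝ)
      ≤ ε * (M + ∑ k ∈ Finset.Icc (K α N - L) (K α N), ((B k).card : ℝ)) :=
        mul_le_mul_of_nonneg_left h1 hε
    _ = ε * M + ∑ k ∈ Finset.Icc (K α N - L) (K α N), ε * ((B k).card : ℝ) := by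
        rw [mul_add, Finset.mul_sum]
    _ ≤ ε * (η * N + 1) + ∑ k ∈ Finset.Icc (K α N - L) (K α N),
          ∑ s ∈ Finset.range N, D (shift^[s] x) := by
        refine add_le_add (mul_le_mul_of_nonneg_left (Nat.ceil_lt_add_one hηN).le hε)
          (Finset.sum_le_sum fun k _ => mul_card_largeAverage_level_le x hD hε N k)
    _ ≤ _ := by
        rw [Finset.sum_const, nsmul_eq_mul, Nat.card_Icc]
        refine add_le_add le_rfl (mul_le_mul_of_nonneg_right ?_ hS)
        have : K α N + 1 - (K α N - L) ≤ L + 1 := by omega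
        exact_mod_cast this

open Classical in
-- The shift a is read as the time n + a < 2n, always with the one length K_n, so no loss over
-- several lengths occurs.
lemma mul_card_largeAverage_shift_le (x : ℤ → α) {D : (ℤ → α) → ℝ} (hD : ∀ x, 0 ≤ D x) {ε : ℝ}
    (hε : 0 ≤ ε) (n : ℕ) :
    ε * ({a ∈ Finset.range n | shift^[a] x ∈ largeAverageSet D ε n} : Finset ℕ).card ≤
      ∑ s ∈ Finset.range (2 * n), D (shift^[s] x) := by
  set k := K α n with hk
  have hk1 : 1 ≤ k := one_le_K n
  set A : Finset ℕ := {a ∈ Finset.range n | shift^[a] x ∈ largeAverageSet D ε n} with hA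
  have := mul_card_le_sum_of_window_average (fun m : ℕ => word x k m) (fun s => D (shift^[s] x))
    (fun s => hD _) hε (fun m => m - n + (k - 1)) (2 * n) (A.map (addLeftEmbedding n)) ?_ ?_
  · rwa [Finset.card_map] at this
  · intro m hm
    simp only [hA, Finset.mem_map, Finset.mem_filter, Finset.mem_range,
      addLeftEmbedding_apply] at hm
    omega
  · intro m hm
    simp only [hA, Finset.mem_map, Finset.mem_filter, Finset.mem_range,
      addLeftEmbedding_apply] at hm
    obtain ⟨a, ⟨-, hs⟩, rfl⟩ := hm
    have hs' : ε * (matchTimes (shift^[a] x) k n).card <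
      ∑ s ∈ matchTimes (shift^[a] x) k n, D (shift^[s] (shift^[a] x)) := hs
    simp only [← Function.iterate_add_apply] at hs'
    rw [card_matchTimes_shift x hk1,
      sum_matchTimes_shift x hk1 n a fun s => D (shift^[s] x)] at hs'
    simp only [Nat.add_sub_cancel_left]
    convert hs'

end Counting

/-! ### Probabilities of the exceptional sets -/

section Probability

lemma exists_bound {α : Type*} [Fintype α] (g : α → ℝ) : ∃ C > 0, ∀ a, |g a| ≤ C := by
  refine ⟨∑ a, |g a| + 1, by positivity, fun a => ?_⟩
  have := Finset.single_le_sum (f := fun a => |g a|) (fun a _ => abs_nonneg _) (Finset.mem_univ a)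
  linarith

variable {α : Type*} [MeasurableSpace α] {ν : Measure (ℤ → α)}

lemma integral_sum_shift (hT : MeasurePreserving shift ν ν) {D : (ℤ → α) → ℝ}
    (hDi : Integrable D ν) (N : ℕ) :
    ∫ x, ∑ s ∈ Finset.range N, D (shift^[s] x) ∂ν = N * ∫ x, D x ∂ν := by
  have hi : ∀ s, Integrable (fun x => D (shift^[s] x)) ν := fun s =>
    (hT.iterate s).integrable_comp_of_integrable hDi
  rw [integral_finsetSum _ fun s _ => hi s]
  have : ∀ s : ℕ, ∫ x, D (shift^[s] x) ∂ν = ∫ x, D x ∂ν := by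
    intro s
    have h := hT.iterate s
    conv_rhs => rw [← h.map_eq]
    refine (integral_map h.measurable.aemeasurable ?_).symm
    rw [h.map_eq]; exact hDi.aestronglyMeasurable
  simp [this]

variable [IsProbabilityMeasure ν]

open Classical in
-- Turns a count over the shifts of each single realization into a bound on a probability, by
-- stationarity alone.
lemma mul_measureReal_eq_integral_card (hT : MeasurePreserving shift ν ν) {A : Set (ℤ → α)}
    (hA : MeasurableSet A) (n : ℕ) :
    n * ν.real A = ∫ x, (({a ∈ Finset.range n | shift^[a] x ∈ A} : Finset ℕ).card : ℝ) ∂ν ∧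
      Integrable (fun x => (({a ∈ Finset.range n | shift^[a] x ∈ A} : Finset ℕ).card : ℝ)) ν := by
  have e : (fun x => (({a ∈ Finset.range n | shift^[a] x ∈ A} : Finset ℕ).card : ℝ)) =
      fun x => ∑ a ∈ Finset.range n, (shift^[a] ⁻¹' A).indicator 1 x := by
    funext x
    rw [Finset.card_filter, Nat.cast_sum]
    refine Finset.sum_congr rfl fun a _ => ?_
    by_cases h : shift^[a] x ∈ A <;> simp [h]
  have hm : ∀ a, MeasurableSet (shift^[a] ⁻¹' A) := fun a => (hT.iterate a).measurable hA
  have hi : ∀ a, Integrable ((shift^[a] ⁻¹' A).indicator (1 : (ℤ → α) → ℝ)) ν := fun a =>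
    (integrable_const (1 : ℝ)).indicator (hm a)
  refine ⟨?_, ?_⟩
  · rw [e, integral_finsetSum _ fun a _ => hi a]
    have : ∀ a, ∫ x, (shift^[a] ⁻¹' A).indicator (1 : (ℤ → α) → ℝ) x ∂ν = ν.real A := by
      intro a
      rw [integral_indicator_one (hm a)]
      exact (hT.iterate a).measureReal_preimage hA.nullMeasurableSet
    simp [this]
  · rw [e]
    exact integrable_finsetSum _ fun a _ => hi a

variable [Fintype α] [MeasurableSingletonClass α]

lemma measurableSet_scarceSet (n : ℕ) : MeasurableSet (scarceSet α n) := by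
  have : scarceSet α n = {x | ((matchTimes x (K α n) n).card : ℝ) < J n} := by
    ext x; simp [scarceSet]
  rw [this]
  exact measurableSet_lt (measurable_card_matchTimes _ _) measurable_const

lemma measurableSet_largeAverageSet {D : (ℤ → α) → ℝ} (hD : Measurable D) (ε : ℝ) (n : ℕ) :
    MeasurableSet (largeAverageSet D ε n) :=
  measurableSet_lt ((measurable_card_matchTimes _ _).const_mul ε)
    (measurable_sum_matchTimes _ _ fun s => hD.comp (measurable_shift.iterate s))

lemma measureReal_scarceSet_le [Nonempty α] (hT : MeasurePreserving shift ν ν) (n : ℕ) :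
    n * ν.real (scarceSet α n) ≤ (Fintype.card α : ℝ) ^ K α n * J n + K α n := by
  classical
  obtain ⟨h1, h2⟩ := mul_measureReal_eq_integral_card hT (measurableSet_scarceSet (α := α) n) n
  rw [h1]
  calc _ ≤ ∫ _, ((Fintype.card α : ℝ) ^ K α n * J n + K α n) ∂ν := by
        refine integral_mono h2 (integrable_const _) fun x => ?_
        have h := (Nat.cast_le (α := ℝ)).2 (card_scarce_shift_le x n)
        push_cast at h
        exact h
    _ = _ := by simp

lemma measureReal_largeAverageSet_le (hT : MeasurePreserving shift ν ν) {D : (ℤ → α) → ℝ}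
    (hD : Measurable D) (hD0 : ∀ x, 0 ≤ D x) (hDi : Integrable D ν) {ε : ℝ} (hε : 0 < ε) {n : ℕ}
    (hn : 1 ≤ n) : ν.real (largeAverageSet D ε n) ≤ 2 * (∫ x, D x ∂ν) / ε := by
  classical
  obtain ⟨h1, h2⟩ := mul_measureReal_eq_integral_card hT (measurableSet_largeAverageSet hD ε n) n
  have hn' : (0 : ℝ) < n := by exact_mod_cast hn
  have h3 : ε * (n * ν.real (largeAverageSet D ε n)) ≤ (2 * n : ℕ) * ∫ x, D x ∂ν := by
    rw [h1, ← integral_sum_shift hT hDi, ← integral_const_mul]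
    exact integral_mono (h2.const_mul ε)
      (integrable_finsetSum _ fun s _ => (hT.iterate s).integrable_comp_of_integrable hDi)
      fun x => mul_card_largeAverage_shift_le x hD0 hε.le n
  rw [le_div_iff₀ hε]
  push_cast at h3
  have : n * (ν.real (largeAverageSet D ε n) * ε) ≤ n * (2 * ∫ x, D x ∂ν) := by linarith
  exact le_of_mul_le_mul_left this hn'

/-- The realizations for which some admissible and frequent word at time `n` has a large average
deviation of the next letter from its conditional mean. -/
def deviationSet (ν : Measure (ℤ → α)) (g : α → ℝ) (ε : ℝ) (n : ℕ) : Set (ℤ → α) :=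
  {x | ∃ k ≤ K α n, (J n : ℝ) ≤ (matchTimes x k n).card ∧ ε * (matchTimes x k n).card <
    |∑ s ∈ matchTimes x k n, (g (x ((s : ℤ) + 1)) - pastMean ν g (shift^[s] x))|}

/-- The context at time n is random and not predictable at time s < n. For a fixed word the
selection of times is predictable, so the tail bound is applied to every word and summed. -/
lemma exists_measureReal_deviationSet_le [Nonempty α] (hT : MeasurePreserving shift ν ν) (g : α → ℝ)
    {ε : ℝ} (hε : 0 < ε) : ∃ δ > 0, ∀ n, ν.real (deviationSet ν g ε n) ≤
      2 * (((K α n + 1 : ℕ) : ℝ) * ((Fintype.card α : ℝ) ^ K α n * Real.exp (-δ * J n))) := by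
  classical
  obtain ⟨C, hC0, hC⟩ := exists_bound g
  -- The largest θ allowed by both constraints of the tail bound, 2Cθ ≤ 1 and 2θ(2C)² ≤ ε.
  set θ : ℝ := min (1 / (2 * C)) (ε / (2 * (2 * C) ^ 2)) with hθ
  have hθ0 : 0 < θ := lt_min (by positivity) (by positivity)
  have hθ1 : θ * (2 * C) ≤ 1 := (le_div_iff₀ (by positivity)).1 (min_le_left _ _)
  have hθ2 : 2 * (θ * (2 * C) ^ 2) ≤ ε := by
    have := (le_div_iff₀ (by positivity)).1 (min_le_right (1 / (2 * C)) (ε / (2 * (2 * C) ^ 2)))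
    rw [← hθ] at this
    linarith
  refine ⟨θ * ε / 2, by positivity, fun n => ?_⟩
  set ℱ : ℕ → MeasurableSpace (ℤ → α) := fun s => sigmaOf coord (Set.Iic (s : ℤ)) with hℱ
  have hmono : Monotone ℱ := fun s t hst => sigmaOf_mono _ (Set.Iic_subset_Iic.2 (by exact_mod_cast hst))
  set Y : ℕ → (ℤ → α) → ℝ := fun s x => g (x ((s : ℤ) + 1)) with hY
  set c : (k : ℕ) → (Fin k → α) → ℕ → (ℤ → α) → ℝ := fun k w s x =>
    if k ≤ s + 1 ∧ word x k s = w then 1 else 0 with hc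
  have hcm : ∀ k w s, StronglyMeasurable[ℱ s] (c k w s) := by
    intro k w s
    have hw : Measurable[ℱ s] fun x : ℤ → α => word x k s :=
      @measurable_pi_lambda _ _ _ (ℱ s) _ _ fun j =>
        measurable_sigmaOf coord (i := (s : ℤ) - (j : ℕ)) (by simp)
    refine Measurable.stronglyMeasurable (Measurable.ite ?_ measurable_const measurable_const)
    by_cases h : k ≤ s + 1
    · simp only [h, true_and]
      exact hw (measurableSet_singleton w)
    · simp [h]
  have hYm : ∀ s, StronglyMeasurable[ℱ (s + 1)] (Y s) := by
    intro s
    have h1 : Measurable[ℱ (s + 1)] (coord (α := α) ((s : ℤ) + 1)) :=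
      measurable_sigmaOf coord (by simp)
    exact ((measurable_of_countable g).comp h1).stronglyMeasurable
  set E : (k : ℕ) → (Fin k → α) → Set (ℤ → α) := fun k w =>
    {x | (J n : ℝ) ≤ ∑ s ∈ Finset.range n, c k w s x ∧ ε * ∑ s ∈ Finset.range n, c k w s x <
        |∑ s ∈ Finset.range n, c k w s x * (Y s x - (ν[Y s | ℱ s]) x)|} with hE
  have hEle : ∀ k w, ν.real (E k w) ≤ 2 * Real.exp (-(θ * ε / 2) * J n) := fun k w =>
    measureReal_weighted_martingale_le ℱ hmono (fun s => sigmaOf_coord_le _) (c k w) Y (hcm k w)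
      (fun s x => by simp only [hc]; split_ifs <;> simp) hYm (fun s x => hC _) hθ0 hθ1 hθ2 n (J n)
  -- Only almost everywhere, since the conditional mean at time s agrees with `pastMean` along the
  -- orbit only up to a null set.
  have hsub : deviationSet ν g ε n ≤ᵐ[ν]
      (⋃ k ∈ Finset.range (K α n + 1), ⋃ w ∈ (Finset.univ : Finset (Fin k → α)), E k w :
        Set (ℤ → α)) := by
    have hall := ae_all_iff.2 fun s : ℕ => condExp_Iic_eq (ν := ν) g hT s
    filter_upwards [hall] with x hx
    rintro ⟨k, hk, h1, h2⟩
    refine Set.mem_iUnion₂.2 ?_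
    simp only [Set.mem_iUnion]
    refine ⟨k, Finset.mem_range.2 (by omega), word x k n, Finset.mem_univ _, ?_⟩
    have hcard : ∑ s ∈ Finset.range n, c k (word x k n) s x = (matchTimes x k n).card := by
      simp only [hc, matchTimes, Finset.sum_boole]
    have hsum : ∑ s ∈ Finset.range n, c k (word x k n) s x * (Y s x - (ν[Y s | ℱ s]) x) =
        ∑ s ∈ matchTimes x k n, (g (x ((s : ℤ) + 1)) - pastMean ν g (shift^[s] x)) := by
      simp only [matchTimes, Finset.sum_filter]
      refine Finset.sum_congr rfl fun s _ => ?_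
      simp only [hc, ite_mul, one_mul, zero_mul]
      have := hx s
      simp only [hY, hℱ]
      rw [this]
    refine ⟨?_, ?_⟩
    · rw [hcard]; exact h1
    · rw [hcard, hsum]; exact h2
  calc ν.real (deviationSet ν g ε n)
      ≤ ν.real (⋃ k ∈ Finset.range (K α n + 1), ⋃ w ∈ (Finset.univ : Finset (Fin k → α)), E k w) :=
        ENNReal.toReal_mono (measure_ne_top _ _) (measure_mono_ae hsub)
    _ ≤ ∑ k ∈ Finset.range (K α n + 1),
          ν.real (⋃ w ∈ (Finset.univ : Finset (Fin k → α)), E k w) :=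
        measureReal_biUnion_finset_le _ _
    _ ≤ ∑ k ∈ Finset.range (K α n + 1),
          (Fintype.card α : ℝ) ^ K α n * (2 * Real.exp (-(θ * ε / 2) * J n)) := by
        refine Finset.sum_le_sum fun k hk => ?_
        refine (measureReal_biUnion_finset_le _ _).trans ?_
        refine (Finset.sum_le_sum fun w _ => hEle k w).trans ?_
        rw [Finset.sum_const, nsmul_eq_mul]
        refine mul_le_mul_of_nonneg_right ?_ (by positivity)
        rw [Finset.card_univ]
        exact_mod_cast card_words_le (α := α) (Nat.lt_succ_iff.1 (Finset.mem_range.1 hk))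
    _ = _ := by
        rw [Finset.sum_const, Finset.card_range, nsmul_eq_mul]
        ring

lemma summable_measureReal_deviationSet [Nonempty α] (hT : MeasurePreserving shift ν ν) (g : α → ℝ)
    {ε : ℝ} (hε : 0 < ε) : Summable fun n => ν.real (deviationSet ν g ε n) := by
  obtain ⟨δ, hδ, h⟩ := exists_measureReal_deviationSet_le hT g hε
  exact Summable.of_nonneg_of_le (fun n => measureReal_nonneg) h
    ((summable_words_mul_exp hδ).mul_left 2)

lemma ae_eventually_notMem_deviationSet [Nonempty α] (hT : MeasurePreserving shift ν ν) (g : α → ℝ)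
    {ε : ℝ} (hε : 0 < ε) : ∀ᵐ x ∂ν, ∀ᶠ n in atTop, x ∉ deviationSet ν g ε n := by
  refine ae_eventually_notMem ?_
  have h := (summable_measureReal_deviationSet hT g hε).tsum_ofReal_ne_top
  have e : ∀ n, ENNReal.ofReal (ν.real (deviationSet ν g ε n)) = ν (deviationSet ν g ε n) :=
    fun n => ofReal_measureReal
  simpa only [e] using h

end Probability

/-! ### Calculus of upper limits of averages -/

section Averages

/-- The upper limit of the averages of `u` is at most `q`. -/
def AvgLE (u : ℕ → ℝ) (q : ℝ) : Prop :=
  ∀ q' > q, ∀ᶠ N : ℕ in atTop, ∑ m ∈ Finset.range N, u m ≤ q' * N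

lemma eventually_mul_add_le {p q : ℝ} (h : p < q) (R : ℝ) :
    ∀ᶠ N : ℕ in atTop, p * N + R ≤ q * N := by
  have : Tendsto (fun N : ℕ => (q - p) * (N : ℝ)) atTop atTop :=
    tendsto_natCast_atTop_atTop.const_mul_atTop (sub_pos.2 h)
  filter_upwards [this.eventually_ge_atTop R] with N hN
  linarith

lemma AvgLE.of_bound {u : ℕ → ℝ} {q : ℝ}
    (h : ∀ q' > q, ∃ R : ℝ, ∀ᶠ N : ℕ in atTop, ∑ m ∈ Finset.range N, u m ≤ q' * N + R) :
    AvgLE u q := by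
  intro q' hq'
  obtain ⟨R, hR⟩ := h ((q + q') / 2) (by linarith)
  filter_upwards [hR, eventually_mul_add_le (show (q + q') / 2 < q' by linarith) R] with N h1 h2
  exact h1.trans h2

lemma AvgLE.add {u v : ℕ → ℝ} {p q : ℝ} (hu : AvgLE u p) (hv : AvgLE v q) :
    AvgLE (fun m => u m + v m) (p + q) := by
  intro q' hq'
  filter_upwards [hu (p + (q' - p - q) / 2) (by linarith),
    hv (q + (q' - p - q) / 2) (by linarith)] with N h1 h2
  rw [Finset.sum_add_distrib]
  linarith

lemma AvgLE.mono {u : ℕ → ℝ} {p q : ℝ} (hu : AvgLE u p) (h : p ≤ q) : AvgLE u q :=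
  fun q' hq' => hu q' (h.trans_lt hq')

lemma AvgLE.of_forall_pos {u : ℕ → ℝ} {q : ℝ} (h : ∀ δ > 0, AvgLE u (q + δ)) : AvgLE u q :=
  fun q' hq' => h ((q' - q) / 2) (by linarith) q' (by linarith)

lemma AvgLE.const_mul {u : ℕ → ℝ} {q c : ℝ} (hc : 0 < c) (hu : AvgLE u q) :
    AvgLE (fun m => c * u m) (c * q) := by
  intro q' hq'
  filter_upwards [hu (q' / c) (by rwa [gt_iff_lt, lt_div_iff₀ hc, mul_comm])] with N h
  rw [← Finset.mul_sum]
  calc c * ∑ m ∈ Finset.range N, u m ≤ c * (q' / c * N) := mul_le_mul_of_nonneg_left h hc.le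
    _ = q' * N := by field_simp

lemma avgLE_const (c : ℝ) : AvgLE (fun _ => c) c :=
  AvgLE.of_bound fun q' hq' => ⟨0, Eventually.of_forall fun N => by
    simp only [Finset.sum_const, Finset.card_range, nsmul_eq_mul, add_zero]
    nlinarith [Nat.cast_nonneg (α := ℝ) N]⟩

lemma AvgLE.of_eventually_le {u v : ℕ → ℝ} {q : ℝ} (hv : AvgLE v q) (h : ∀ᶠ m in atTop, u m ≤ v m) :
    AvgLE u q := by
  obtain ⟨M, hM⟩ := eventually_atTop.1 h
  refine AvgLE.of_bound fun q' hq' => ⟨∑ m ∈ Finset.range M, |u m - v m|, ?_⟩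
  filter_upwards [hv q' hq', eventually_ge_atTop M] with N hN hMN
  have h1 : ∑ m ∈ Finset.range N, (u m - v m) ≤ ∑ m ∈ Finset.range M, |u m - v m| := by
    rw [← Finset.sum_range_add_sum_Ico _ hMN]
    have a1 : ∑ m ∈ Finset.range M, (u m - v m) ≤ ∑ m ∈ Finset.range M, |u m - v m| :=
      Finset.sum_le_sum fun m _ => le_abs_self _
    have a2 : ∑ m ∈ Finset.Ico M N, (u m - v m) ≤ 0 :=
      Finset.sum_nonpos fun m hm => by linarith [hM m (Finset.mem_Ico.1 hm).1]
    linarith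
  rw [Finset.sum_sub_distrib] at h1
  linarith

lemma AvgLE.tendsto {u : ℕ → ℝ} (hu : ∀ m, 0 ≤ u m) (h : AvgLE u 0) :
    Tendsto (fun N : ℕ => (1 / (N : ℝ)) * ∑ m ∈ Finset.range N, u m) atTop (𝓝 0) := by
  rw [Metric.tendsto_atTop']
  intro ε hε
  obtain ⟨M, hM⟩ := eventually_atTop.1 (h (ε / 2) (by linarith))
  refine ⟨M, fun N hN => ?_⟩
  have hN0 : (0 : ℝ) < N := by exact_mod_cast (Nat.zero_le M).trans_lt hN
  have h0 : 0 ≤ ∑ m ∈ Finset.range N, u m := Finset.sum_nonneg fun m _ => hu m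
  rw [Real.dist_eq, sub_zero, abs_of_nonneg (by positivity), one_div, inv_mul_lt_iff₀ hN0]
  have := hM N hN.le
  nlinarith

end Averages

/-! ### Convergence in the mean and in probability -/

section Mean

/-- Matching `K n` letters eventually forces matching any given number of letters. -/
lemma eventually_word_K_eq {α : Type*} [Fintype α] (k : ℕ) :
    ∀ᶠ n : ℕ in atTop, ∀ (x : ℤ → α) (a b : ℤ),
    word x (K α n) a = word x (K α n) b → word x k a = word x k b := by
  filter_upwards [eventually_word_eq (α := α) k] with n hn x a b
  exact hn x a b _ (min_le_right _ _)

variable {α : Type*} [MeasurableSpace α] {ν : Measure (ℤ → α)}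

/-- The distance between the conditional means given the whole past and given the last `k + 1`
letters. -/
noncomputable def meanGap (ν : Measure (ℤ → α)) (g : α → ℝ) (k : ℕ) (x : ℤ → α) : ℝ :=
  |pastMean ν g x - recentMean ν g k x|

variable (g : α → ℝ)

lemma meanGap_nonneg (k : ℕ) (x : ℤ → α) : 0 ≤ meanGap ν g k x := abs_nonneg _

lemma measurable_meanGap (k : ℕ) : Measurable (meanGap ν g k) :=
  ((measurable_pastMean g).sub (measurable_recentMean g k)).abs

lemma integrable_meanGap (k : ℕ) : Integrable (meanGap ν g k) ν :=
  (integrable_condExp.sub integrable_condExp).abs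

variable {g} in
lemma ae_meanGap_le {C : ℝ} (hg : ∀ a, |g a| ≤ C) (k : ℕ) : ∀ᵐ x ∂ν, meanGap ν g k x ≤ 2 * C := by
  filter_upwards [ae_abs_pastMean_le (ν := ν) hg, ae_abs_recentMean_le (ν := ν) hg k] with x h1 h2
  have := abs_sub (pastMean ν g x) (recentMean ν g k x)
  rw [meanGap]
  linarith

/-- Off the exceptional sets the prediction error is controlled by conditional means. -/
lemma abs_estimator_sub_le [Fintype α] {ε : ℝ} {k n : ℕ} (x : ℤ → α)
    (hw : ∀ a b : ℤ, word x (K α n) a = word x (K α n) b → word x (k + 1) a = word x (k + 1) b)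
    (h1 : x ∉ scarceSet α n) (h2 : x ∉ deviationSet ν g ε n)
    (h3 : x ∉ largeAverageSet (meanGap ν g k) ε n) :
    |estimator g x n - recentMean ν g n (shift^[n] x)| ≤
      2 * ε + meanGap ν g k (shift^[n] x) + meanGap ν g n (shift^[n] x) := by
  have hJ : J n ≤ (matchTimes x (K α n) n).card := not_lt.1 h1
  have hκ := kappa_eq_K x hJ
  rw [estimator_eq g x (hκ ▸ one_le_K n), hκ]
  set S := matchTimes x (K α n) n with hS
  have hc : (0 : ℝ) < S.card := by exact_mod_cast (one_le_J n).trans hJ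
  have hdev : |∑ s ∈ S, (g (x ((s : ℤ) + 1)) - pastMean ν g (shift^[s] x))| ≤ ε * S.card := by
    by_contra hlt
    exact h2 ⟨K α n, le_rfl, by exact_mod_cast hJ, not_le.1 hlt⟩
  have hlarge : ∑ s ∈ S, meanGap ν g k (shift^[s] x) ≤ ε * S.card := not_lt.1 h3
  -- The finite-past mean depends on k + 1 letters, all of which agree at the match times. So it can
  -- be moved from s to n, leaving only the average of `meanGap`.
  have hloc : ∀ s ∈ S, recentMean ν g k (shift^[s] x) = recentMean ν g k (shift^[n] x) := by
    intro s hs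
    refine recentMean_eq_of_word_eq g ?_
    rw [word_shift_iterate, word_shift_iterate, zero_add, zero_add]
    simp only [hS, matchTimes, Finset.mem_filter] at hs
    exact hw _ _ hs.2.2
  have hmain : |∑ s ∈ S, g (x ((s : ℤ) + 1)) - S.card * recentMean ν g k (shift^[n] x)| ≤
      2 * ε * S.card := by
    have e : ∑ s ∈ S, g (x ((s : ℤ) + 1)) - S.card * recentMean ν g k (shift^[n] x) =
        ∑ s ∈ S, (g (x ((s : ℤ) + 1)) - pastMean ν g (shift^[s] x)) +
        ∑ s ∈ S, (pastMean ν g (shift^[s] x) - recentMean ν g k (shift^[s] x)) := by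
      rw [← Finset.sum_add_distrib, Finset.sum_congr rfl
        (fun (s : ℕ) _ => sub_add_sub_cancel (g (x ((s : ℤ) + 1))) (pastMean ν g (shift^[s] x))
          (recentMean ν g k (shift^[s] x))), Finset.sum_sub_distrib, Finset.sum_congr rfl hloc,
        Finset.sum_const, nsmul_eq_mul]
    rw [e]
    refine (abs_add_le _ _).trans ?_
    have : |∑ s ∈ S, (pastMean ν g (shift^[s] x) - recentMean ν g k (shift^[s] x))| ≤
        ∑ s ∈ S, meanGap ν g k (shift^[s] x) := Finset.abs_sum_le_sum_abs _ _
    linarith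
  have havg : |1 / (S.card : ℝ) * ∑ s ∈ S, g (x ((s : ℤ) + 1)) -
      recentMean ν g k (shift^[n] x)| ≤ 2 * ε := by
    have e : 1 / (S.card : ℝ) * ∑ s ∈ S, g (x ((s : ℤ) + 1)) - recentMean ν g k (shift^[n] x) =
        (∑ s ∈ S, g (x ((s : ℤ) + 1)) - S.card * recentMean ν g k (shift^[n] x)) / S.card := by
      field_simp
    rw [e, abs_div, abs_of_pos hc, div_le_iff₀ hc]
    exact hmain
  have t1 := abs_sub_le (1 / (S.card : ℝ) * ∑ s ∈ S, g (x ((s : ℤ) + 1)))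
    (recentMean ν g k (shift^[n] x)) (recentMean ν g n (shift^[n] x))
  have t2 := abs_sub_le (recentMean ν g k (shift^[n] x)) (pastMean ν g (shift^[n] x))
    (recentMean ν g n (shift^[n] x))
  have t3 := abs_sub_comm (recentMean ν g k (shift^[n] x)) (pastMean ν g (shift^[n] x))
  simp only [meanGap]
  linarith

variable [IsProbabilityMeasure ν]

lemma ae_tendsto_meanGap : ∀ᵐ x ∂ν, Tendsto (fun k => meanGap ν g k x) atTop (𝓝 0) := by
  filter_upwards [ae_tendsto_recentMean (ν := ν) g] with x hx
  have := (tendsto_const_nhds (x := pastMean ν g x)).sub hx |>.abs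
  simpa [meanGap] using this

lemma ae_avgLE (hT : Ergodic shift ν) {f : (ℤ → α) → ℝ} (hfm : Measurable f)
    (hf : Integrable f ν) : ∀ᵐ x ∂ν, AvgLE (fun m => f (shift^[m] x)) (∫ x, f x ∂ν) := by
  have h : ∀ᵐ x ∂ν, ∀ j : ℕ, ∃ R : ℝ, ∀ N : ℕ, ∑ i ∈ Finset.range N, f (shift^[i] x) ≤
      (∫ x, f x ∂ν + 1 / ((j : ℝ) + 1)) * N + R :=
    ae_all_iff.2 fun j => ae_exists_birkhoffSum_le hT hfm hf (by
      have : 0 < 1 / ((j : ℝ) + 1) := by positivity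
      linarith)
  filter_upwards [h] with x hx
  refine AvgLE.of_bound fun q' hq' => ?_
  obtain ⟨j, hj⟩ := exists_nat_one_div_lt (sub_pos.2 hq')
  obtain ⟨R, hR⟩ := hx j
  refine ⟨R, Eventually.of_forall fun N => (hR N).trans ?_⟩
  have : (∫ x, f x ∂ν + 1 / ((j : ℝ) + 1)) * N ≤ q' * N :=
    mul_le_mul_of_nonneg_right (by linarith) (Nat.cast_nonneg N)
  linarith

lemma ae_avgLE_indicator (hT : Ergodic shift ν) {A : Set (ℤ → α)} (hA : MeasurableSet A) :
    ∀ᵐ x ∂ν, AvgLE (fun m => A.indicator (1 : (ℤ → α) → ℝ) (shift^[m] x)) (ν.real A) := by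
  have := ae_avgLE hT (f := A.indicator (1 : (ℤ → α) → ℝ)) (measurable_one.indicator hA)
    ((integrable_const (1 : ℝ)).indicator hA)
  rwa [integral_indicator_one hA] at this

variable [Fintype α]

lemma tendsto_integral_meanGap : Tendsto (fun k => ∫ x, meanGap ν g k x ∂ν) atTop (𝓝 0) := by
  obtain ⟨C, -, hC⟩ := exists_bound g
  have := tendsto_integral_of_dominated_convergence (μ := ν) (F := meanGap ν g) (f := fun _ => 0)
    (fun _ => 2 * C) (fun k => (measurable_meanGap g k).aestronglyMeasurable) (integrable_const _)
    (fun k => by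
      filter_upwards [ae_meanGap_le (ν := ν) hC k] with x hx
      rwa [Real.norm_of_nonneg (meanGap_nonneg g k x)]) (ae_tendsto_meanGap g)
  simpa using this

/-- Breiman's argument: for m ≥ M the gap is at most δ plus 2C times the indicator of the event that
some later gap exceeds δ. That event no longer depends on m and has small probability for large M.
-/
lemma ae_avgLE_meanGap_diagonal (hT : Ergodic shift ν) :
    ∀ᵐ x ∂ν, AvgLE (fun m => meanGap ν g m (shift^[m] x)) 0 := by
  obtain ⟨C, hC0, hC⟩ := exists_bound g
  have key : ∀ j : ℕ, ∀ᵐ x ∂ν,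
      AvgLE (fun m => meanGap ν g m (shift^[m] x)) ((1 + 2 * C) * (1 / ((j : ℝ) + 1))) := by
    intro j
    set δ : ℝ := 1 / ((j : ℝ) + 1) with hδ
    have hδ0 : 0 < δ := by positivity
    set A : ℕ → Set (ℤ → α) := fun M => {x | ∃ m ≥ M, δ < meanGap ν g m x} with hA
    have hAm : ∀ M, MeasurableSet (A M) := by
      intro M
      have : A M = ⋃ m, ⋃ (_ : m ≥ M), {x | δ < meanGap ν g m x} := by
        ext x; simp [hA]
      rw [this]
      exact MeasurableSet.iUnion fun m => MeasurableSet.iUnion fun _ =>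
        measurableSet_lt measurable_const (measurable_meanGap g m)
    have hlim : Tendsto (fun M => ∫ x, (A M).indicator (1 : (ℤ → α) → ℝ) x ∂ν) atTop (𝓝 0) := by
      have := tendsto_integral_of_dominated_convergence (μ := ν)
        (F := fun M => (A M).indicator (1 : (ℤ → α) → ℝ)) (f := fun _ => 0)
        (fun _ => 1) (fun M => (measurable_one.indicator (hAm M)).aestronglyMeasurable)
        (integrable_const _) (fun M => Eventually.of_forall fun x => by
          by_cases h : x ∈ A M <;> simp [h]) (by
        filter_upwards [ae_tendsto_meanGap (ν := ν) g] with x hx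
        obtain ⟨M, hM⟩ := eventually_atTop.1 (hx.eventually (gt_mem_nhds hδ0))
        refine tendsto_const_nhds.congr' ?_
        filter_upwards [eventually_ge_atTop M] with M' hM'
        refine (Set.indicator_of_notMem ?_ _).symm
        rintro ⟨m, hm, h⟩
        exact absurd h (hM m (hM'.trans hm)).not_gt)
      simpa using this
    obtain ⟨M, hM⟩ := (hlim.eventually (gt_mem_nhds hδ0)).exists
    rw [integral_indicator_one (hAm M)] at hM
    have hb : ∀ᵐ x ∂ν, ∀ m, meanGap ν g m x ≤ 2 * C := ae_all_iff.2 fun m => ae_meanGap_le hC m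
    filter_upwards [ae_avgLE_indicator hT (hAm M), ae_all_shift hT.toMeasurePreserving hb]
      with x h1 h2
    have h3 := (avgLE_const δ).add (h1.const_mul (c := 2 * C) (by positivity))
    refine (h3.of_eventually_le ?_).mono ?_
    · filter_upwards [eventually_ge_atTop M] with m hm
      by_cases h : shift^[m] x ∈ A M
      · rw [Set.indicator_of_mem h]
        have := h2 m m
        simp only [Pi.one_apply]
        linarith
      · rw [Set.indicator_of_notMem h]
        have : ¬ δ < meanGap ν g m (shift^[m] x) := fun hlt => h ⟨m, hm, hlt⟩
        linarith
    · have : 2 * C * ν.real (A M) ≤ 2 * C * δ := mul_le_mul_of_nonneg_left hM.le (by positivity)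
      linarith
  filter_upwards [ae_all_iff.2 key] with x hx
  refine AvgLE.of_forall_pos fun δ hδ => ?_
  obtain ⟨j, hj⟩ := exists_nat_one_div_lt (show 0 < δ / (1 + 2 * C) by positivity)
  refine (hx j).mono ?_
  rw [lt_div_iff₀ (by positivity)] at hj
  linarith

variable [MeasurableSingletonClass α]

lemma tendsto_measureReal_error [Nonempty α] (hT : MeasurePreserving shift ν ν) {ε : ℝ}
    (hε : 0 < ε) : Tendsto (fun n => ν.real {x | 4 * ε <
      |estimator g x n - recentMean ν g n (shift^[n] x)|}) atTop (𝓝 0) := by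
  have hmeas : ∀ (k n : ℕ), ν.real {x | ε < meanGap ν g k (shift^[n] x)} =
      ν.real {x | ε < meanGap ν g k x} := fun k n =>
    (hT.iterate n).measureReal_preimage
      (measurableSet_lt measurable_const (measurable_meanGap g k)).nullMeasurableSet
  have hmarkov : ∀ k, ν.real {x | ε < meanGap ν g k x} ≤ (∫ x, meanGap ν g k x ∂ν) / ε := by
    intro k
    rw [le_div_iff₀ hε, mul_comm]
    refine le_trans (mul_le_mul_of_nonneg_left (measureReal_mono ?_) hε.le)
      (mul_meas_ge_le_integral_of_nonneg (Eventually.of_forall (meanGap_nonneg g k))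
        (integrable_meanGap g k) ε)
    intro x hx
    exact le_of_lt (show ε < meanGap ν g k x from hx)
  have hscarce : Tendsto (fun n => ν.real (scarceSet α n)) atTop (𝓝 0) := by
    refine squeeze_zero' (Eventually.of_forall fun n => measureReal_nonneg) ?_
      (tendsto_rare_visits (α := α))
    filter_upwards [eventually_ge_atTop 1] with n hn
    have hn' : (0 : ℝ) < n := by exact_mod_cast hn
    rw [le_div_iff₀ hn', mul_comm]
    refine (measureReal_scarceSet_le hT n).trans (le_mul_of_one_le_left (by positivity) ?_)
    push_cast
    linarith [Nat.cast_nonneg (α := ℝ) (K α n)]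
  have hdev := (summable_measureReal_deviationSet hT g hε).tendsto_atTop_zero
  have hgap : Tendsto (fun n => (∫ x, meanGap ν g n x ∂ν) / ε) atTop (𝓝 0) := by
    simpa using (tendsto_integral_meanGap (ν := ν) g).div_const ε
  rw [Metric.tendsto_atTop']
  intro ρ hρ
  -- The large-average event takes two shares of ρ/6 because of the factor 2 in its bound; the other
  -- four events take one each. Here k is fixed before n grows.
  obtain ⟨k, hk⟩ := (hgap.eventually (gt_mem_nhds (show 0 < ρ / 6 by positivity))).exists
  refine eventually_atTop.1 ?_ |>.imp fun M hM n hn => hM n hn.le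
  filter_upwards [hscarce.eventually (gt_mem_nhds (show 0 < ρ / 6 by positivity)),
    hdev.eventually (gt_mem_nhds (show 0 < ρ / 6 by positivity)),
    hgap.eventually (gt_mem_nhds (show 0 < ρ / 6 by positivity)),
    eventually_word_K_eq (α := α) (k + 1), eventually_ge_atTop 1] with n h1 h2 h3 h4 h5
  rw [Real.dist_eq, sub_zero, abs_of_nonneg measureReal_nonneg]
  have hsub : {x | 4 * ε < |estimator g x n - recentMean ν g n (shift^[n] x)|} ⊆
      scarceSet α n ∪ (deviationSet ν g ε n ∪ (largeAverageSet (meanGap ν g k) ε n ∪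
        ({x | ε < meanGap ν g k (shift^[n] x)} ∪ {x | ε < meanGap ν g n (shift^[n] x)}))) := by
    intro x hx
    have hx' : 4 * ε < |estimator g x n - recentMean ν g n (shift^[n] x)| := hx
    by_contra hc
    simp only [Set.mem_union, not_or, Set.mem_ofPred_eq, not_lt] at hc
    obtain ⟨c1, c2, c3, c4, c5⟩ := hc
    have := abs_estimator_sub_le g x (h4 x) c1 c2 c3
    linarith
  have hl := measureReal_largeAverageSet_le hT (measurable_meanGap g k) (meanGap_nonneg g k)
    (integrable_meanGap g k) hε h5
  have e1 := measureReal_mono (μ := ν) hsub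
  have e2 := measureReal_union_le (μ := ν) (scarceSet α n)
    (deviationSet ν g ε n ∪ (largeAverageSet (meanGap ν g k) ε n ∪
        ({x | ε < meanGap ν g k (shift^[n] x)} ∪ {x | ε < meanGap ν g n (shift^[n] x)})))
  have e3 := measureReal_union_le (μ := ν)
    (deviationSet ν g ε n) (largeAverageSet (meanGap ν g k) ε n ∪
        ({x | ε < meanGap ν g k (shift^[n] x)} ∪ {x | ε < meanGap ν g n (shift^[n] x)}))
  have e4 := measureReal_union_le (μ := ν) (largeAverageSet (meanGap ν g k) ε n)
        ({x | ε < meanGap ν g k (shift^[n] x)} ∪ {x | ε < meanGap ν g n (shift^[n] x)})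
  have e5 := measureReal_union_le (μ := ν)
        {x | ε < meanGap ν g k (shift^[n] x)} {x | ε < meanGap ν g n (shift^[n] x)}
  rw [hmeas, hmeas] at e5
  have e6 := hmarkov k
  have e7 := hmarkov n
  rw [mul_div_assoc] at hl
  linarith

lemma ae_avgLE_error [Nonempty α] (hT : Ergodic shift ν) :
    ∀ᵐ x ∂ν, AvgLE (fun m => |estimator g x m - recentMean ν g m (shift^[m] x)|) 0 := by
  classical
  obtain ⟨C, hC0, hC⟩ := exists_bound g
  have hmp := hT.toMeasurePreserving
  have key : ∀ j : ℕ, ∀ᵐ x ∂ν, AvgLE (fun m => |estimator g x m - recentMean ν g m (shift^[m] x)|)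
      ((4 + 4 * C) * (1 / ((j : ℝ) + 1))) := by
    intro j
    set ε : ℝ := 1 / ((j : ℝ) + 1) with hε
    have hε0 : 0 < ε := by positivity
    obtain ⟨L, hL⟩ := exists_K_le_add α hε0
    -- L depends on ε only, so k can be chosen after it. The condition d(L + 1 + ε) < ε² yields both
    -- d ≤ ε and (L + 1)d/ε ≤ ε.
    obtain ⟨k, hk⟩ := ((tendsto_integral_meanGap (ν := ν) g).eventually
      (gt_mem_nhds (show 0 < ε ^ 2 / (L + 1 + ε) by positivity))).exists
    set d := ∫ x, meanGap ν g k x ∂ν with hd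
    have hd0 : 0 ≤ d := integral_nonneg (meanGap_nonneg g k)
    rw [lt_div_iff₀ (by positivity)] at hk
    have hk1 : d ≤ ε := by
      have : d * ε ≤ ε * ε := by nlinarith [mul_nonneg hd0 (show (0 : ℝ) ≤ L + 1 by positivity)]
      exact le_of_mul_le_mul_right this hε0
    have hk2 : (L + 1) * d / ε ≤ ε := by
      rw [div_le_iff₀ hε0]
      nlinarith [mul_nonneg hd0 hε0.le]
    have hb : ∀ᵐ x ∂ν, ∀ m, |recentMean ν g m x| ≤ C :=
      ae_all_iff.2 fun m => ae_abs_recentMean_le hC m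
    filter_upwards [ae_all_shift hmp hb, ae_avgLE hT (measurable_meanGap g k)
      (integrable_meanGap g k), ae_avgLE_meanGap_diagonal g hT,
      ae_eventually_notMem_deviationSet hmp g hε0] with x hx1 hx2 hx3 hx4
    have hscarce : AvgLE (fun m => if x ∈ scarceSet α m then (1 : ℝ) else 0) 0 := by
      intro q hq
      filter_upwards [(tendsto_rare_visits (α := α)).eventually (gt_mem_nhds hq),
        eventually_ge_atTop 1] with N hN hN1
      have hN0 : (0 : ℝ) < N := by exact_mod_cast hN1
      rw [div_lt_iff₀ hN0] at hN
      refine le_trans ?_ hN.le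
      rw [Finset.sum_boole]
      exact_mod_cast (Nat.cast_le (α := ℝ)).2 (card_scarce_le x N)
    have hlarge : AvgLE (fun m => if x ∈ largeAverageSet (meanGap ν g k) ε m then (1 : ℝ) else 0)
        (2 * ε) := by
      refine AvgLE.mono (p := ε + (L + 1) * d / ε) (AvgLE.of_bound fun q hq => ⟨1, ?_⟩)
        (by linarith)
      have hq' : d < (q - ε) * ε / (L + 1) := by
        rw [lt_div_iff₀ (by positivity)]
        have : (L + 1) * d / ε < q - ε := by linarith
        rw [div_lt_iff₀ hε0] at this
        linarith
      filter_upwards [hx2 _ hq'] with N hN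
      rw [Finset.sum_boole]
      have h1 := mul_card_largeAverage_le hε0 hε0.le hL x (meanGap_nonneg (ν := ν) g k) N
      have h2 : (L + 1) * ∑ s ∈ Finset.range N, meanGap ν g k (shift^[s] x) ≤
          (L + 1) * ((q - ε) * ε / (L + 1) * N) :=
        mul_le_mul_of_nonneg_left hN (by positivity)
      have h3 : ((L : ℝ) + 1) * ((q - ε) * ε / (L + 1) * N) = ε * ((q - ε) * N) := by
        field_simp
      rw [h3] at h2
      refine le_of_mul_le_mul_left ?_ hε0
      linarith
    -- At scarce or large-average times the error is bounded trivially by 2C. The limits add up to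
    -- at most 2ε + ε + 0 + 2C · 2ε.
    have hsum := (((avgLE_const (2 * ε)).add (hx2.add hx3)).add
      ((hscarce.add hlarge).const_mul (c := 2 * C) (by positivity)))
    refine (hsum.of_eventually_le ?_).mono ?_
    · filter_upwards [hx4, eventually_word_K_eq (α := α) (k + 1)] with m h4 hw
      have p1 := meanGap_nonneg (ν := ν) g k (shift^[m] x)
      have p2 := meanGap_nonneg (ν := ν) g m (shift^[m] x)
      have htriv : |estimator g x m - recentMean ν g m (shift^[m] x)| ≤ 2 * C := by
        have := abs_sub (estimator g x m) (recentMean ν g m (shift^[m] x))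
        linarith [abs_estimator_le hC x m, hx1 m m]
      by_cases c1 : x ∈ scarceSet α m
      · rw [if_pos c1]
        split_ifs <;> linarith
      by_cases c2 : x ∈ largeAverageSet (meanGap ν g k) ε m
      · rw [if_pos c2, if_neg c1]
        linarith
      rw [if_neg c1, if_neg c2]
      have := abs_estimator_sub_le g x (hw x) c1 h4 c2
      linarith
    · nlinarith
  filter_upwards [ae_all_iff.2 key] with x hx
  refine AvgLE.of_forall_pos fun δ hδ => ?_
  obtain ⟨j, hj⟩ := exists_nat_one_div_lt (show 0 < δ / (4 + 4 * C) by positivity)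
  refine (hx j).mono ?_
  rw [lt_div_iff₀ (by positivity)] at hj
  linarith

end Mean

/-! ### Almost sure convergence under continuity -/

section Continuity

variable {α : Type*}

lemma dStar_lt_of_agree {x y : ℕ → α} {k : ℕ} (h : ∀ i < k, x i = y i) :
    dStar x y ≤ (2 : ℝ)⁻¹ ^ k := by
  classical
  unfold dStar
  have hs : Summable fun i : ℕ => (2 : ℝ)⁻¹ ^ (i + 1) :=
    (summable_geometric_of_lt_one (by norm_num) (by norm_num)).comp_injective
      (add_left_injective 1)
  have hs' : Summable fun i : ℕ => (2 : ℝ)⁻¹ ^ (i + 1) * (if x i ≠ y i then 1 else 0) := by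
    refine Summable.of_nonneg_of_le (fun i => by positivity) (fun i => ?_) hs
    split_ifs <;> simp
  rw [← hs'.sum_add_tsum_nat_add k, Finset.sum_eq_zero (fun i hi => by
    simp [h i (Finset.mem_range.1 hi)]), zero_add]
  have hk : Summable fun i : ℕ => (2 : ℝ)⁻¹ ^ (i + k + 1) := hs.comp_injective (add_left_injective k)
  calc ∑' i : ℕ, (2 : ℝ)⁻¹ ^ (i + k + 1) * (if x (i + k) ≠ y (i + k) then 1 else 0)
      ≤ ∑' i : ℕ, (2 : ℝ)⁻¹ ^ (i + k + 1) := by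
        refine Summable.tsum_le_tsum (fun i => ?_) (hs'.comp_injective (add_left_injective k)) hk
        split_ifs <;> simp
    _ = (2 : ℝ)⁻¹ ^ k := by
        have e : ∀ i : ℕ, (2 : ℝ)⁻¹ ^ (i + k + 1) = (2⁻¹ ^ k * 2⁻¹) * (2 : ℝ)⁻¹ ^ i := fun i => by ring
        simp only [e]
        rw [tsum_mul_left, tsum_geometric_of_lt_one (by norm_num) (by norm_num)]
        norm_num
        ring

/-- Continuity for `d*` at a point, in terms of the number of agreeing letters. -/
lemma exists_agree_of_dStar_continuous {G : (ℕ → α) → ℝ}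
    (hG : ∀ x, ∀ ε > 0, ∃ δ > 0, ∀ y, dStar x y < δ → |G y - G x| < ε) (x : ℕ → α) {ε : ℝ}
    (hε : 0 < ε) : ∃ k : ℕ, ∀ y, (∀ i < k, x i = y i) → |G y - G x| < ε := by
  obtain ⟨δ, hδ, h⟩ := hG x ε hε
  obtain ⟨k, hk⟩ := exists_pow_lt_of_lt_one hδ (by norm_num : (2 : ℝ)⁻¹ < 1)
  exact ⟨k, fun y hy => h y ((dStar_lt_of_agree hy).trans_lt hk)⟩

lemma isOpen_cylinder [TopologicalSpace α] [DiscreteTopology α] (x : ℕ → α) (k : ℕ) :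
    IsOpen {y : ℕ → α | ∀ i < k, x i = y i} := by
  have : {y : ℕ → α | ∀ i < k, x i = y i} = ⋂ i ∈ Finset.range k, (fun y => y i) ⁻¹' {x i} := by
    ext y; simp [eq_comm]
  rw [this]
  exact isOpen_biInter_finset fun i _ => (isOpen_discrete _).preimage (continuous_apply i)

/-- Heine–Cantor: the space of pasts over a finite alphabet is compact, and finitely many cylinders
of small oscillation cover it. -/
lemma exists_uniform_agree [Finite α] {G : (ℕ → α) → ℝ}
    (hG : ∀ x, ∀ ε > 0, ∃ δ > 0, ∀ y, dStar x y < δ → |G y - G x| < ε) {ε : ℝ} (hε : 0 < ε) :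
    ∃ k : ℕ, ∀ x y, (∀ i < k, x i = y i) → |G x - G y| ≤ ε := by
  let _ : TopologicalSpace α := ⊥
  have : DiscreteTopology α := ⟨rfl⟩
  choose k hk using fun x => exists_agree_of_dStar_continuous hG x (half_pos hε)
  obtain ⟨t, -, ht⟩ := (isCompact_univ (X := ℕ → α)).elim_nhds_subcover
    (fun x => {y : ℕ → α | ∀ i < k x, x i = y i})
    (fun x _ => (isOpen_cylinder x (k x)).mem_nhds (by intro i _; rfl))
  refine ⟨t.sup k, fun x y hxy => ?_⟩
  obtain ⟨z, hz, hzx⟩ := Set.mem_iUnion₂.1 (ht (Set.mem_univ x))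
  have hzx' : ∀ i < k z, z i = x i := hzx
  have hzy : ∀ i < k z, z i = y i := fun i hi =>
    (hzx' i hi).trans (hxy i (hi.trans_le (Finset.le_sup hz)))
  have h1 := hk z x hzx'
  have h2 := hk z y hzy
  have := abs_sub_le (G x) (G z) (G y)
  rw [abs_sub_comm (G z) (G y)] at this
  linarith

lemma measurable_of_dStar_continuous [Finite α] [MeasurableSpace α] [MeasurableSingletonClass α]
    {G : (ℕ → α) → ℝ}
    (hG : ∀ x, ∀ ε > 0, ∃ δ > 0, ∀ y, dStar x y < δ → |G y - G x| < ε) : Measurable G := by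
  let _ : TopologicalSpace α := ⊥
  have : DiscreteTopology α := ⟨rfl⟩
  have : BorelSpace α := ⟨by
    ext s
    exact ⟨fun _ => MeasurableSpace.measurableSet_generateFrom (isOpen_discrete s),
      fun _ => s.toFinite.measurableSet⟩⟩
  refine Continuous.measurable (continuous_iff_continuousAt.2 fun x => ?_)
  rw [ContinuousAt, Metric.tendsto_nhds]
  intro ε hε
  obtain ⟨k, hk⟩ := exists_agree_of_dStar_continuous hG x hε
  filter_upwards [(isOpen_cylinder x k).mem_nhds (show x ∈ {y | ∀ i < k, x i = y i} from
    fun i _ => rfl)] with y hy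
  exact hk y hy

/-- The one-sided past `(…, x_{-1}, x_0)`. -/
def pastOf (x : ℤ → α) (i : ℕ) : α := x (-(i : ℤ))

lemma pastOf_agree {x : ℤ → α} {k a b : ℕ} (h : word x k (a : ℕ) = word x k (b : ℕ)) :
    ∀ i < k, pastOf (shift^[a] x) i = pastOf (shift^[b] x) i := by
  intro i hi
  simp only [pastOf, shift_iterate_apply]
  rw [neg_add_eq_sub, neg_add_eq_sub]
  exact word_eq_apply h hi

variable [Fintype α] [MeasurableSpace α] [MeasurableSingletonClass α]
  {ν : Measure (ℤ → α)} [IsProbabilityMeasure ν]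

/-- Under uniform continuity the means given long finite pasts are uniformly close to the mean given
the whole past. -/
lemma ae_meanGap_le_of_agree (g : α → ℝ) {G : (ℕ → α) → ℝ} {ε : ℝ} {k : ℕ}
    (hG : (fun x => G (pastOf x)) =ᵐ[ν] pastMean ν g)
    (hk : ∀ x y, (∀ i < k, x i = y i) → |G x - G y| ≤ ε) {n : ℕ} (hn : k ≤ n) :
    ∀ᵐ x ∂ν, meanGap ν g n x ≤ 2 * ε := by
  classical
  by_cases hne : Nonempty α
  swap
  · exact Eventually.of_forall fun x => absurd ⟨x 0⟩ hne
  obtain ⟨a0⟩ := hne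
  -- The unseen past is filled with a fixed letter. The result is within ε of G and known from the
  -- last k letters, so conditioning on n ≥ k letters fixes it and keeps the distance at most ε.
  set φ : (Fin k → α) → ℝ := fun w => G fun i => if h : i < k then w ⟨i, h⟩ else a0 with hφ
  have hφi : Integrable (fun x : ℤ → α => φ (word x k 0)) ν :=
    (Integrable.of_finite (μ := ν.map (fun x : ℤ → α => word x k 0)) (f := φ)).comp_measurable
      (measurable_word k 0)
  set m := sigmaOf (coord (α := α)) (Set.Icc (-(n : ℤ)) 0) with hm
  have hmle := sigmaOf_coord_le (α := α) (Set.Icc (-(n : ℤ)) 0)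
  have hGk : ∀ x : ℤ → α, |G (pastOf x) - φ (word x k 0)| ≤ ε := by
    intro x
    refine hk _ _ fun i hi => ?_
    simp [pastOf, word, hi]
  have hφm : StronglyMeasurable[m] fun x : ℤ → α => φ (word x k 0) := by
    have hw : Measurable[m] fun x : ℤ → α => word x k 0 :=
      @measurable_pi_lambda _ _ _ m _ _ fun j =>
        measurable_sigmaOf coord (i := (0 : ℤ) - (j : ℕ)) (by
          have := j.2
          simp only [Set.mem_Icc]
          omega)
    exact ((measurable_of_countable φ).comp hw).stronglyMeasurable
  have hGi : Integrable (fun x => G (pastOf x)) ν := integrable_condExp.congr hG.symm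
  have htower : ν[fun x => G (pastOf x) | m] =ᵐ[ν] recentMean ν g n := by
    refine (condExp_congr_ae hG).trans ?_
    exact condExp_condExp_of_le (sigmaOf_mono coord fun i hi => hi.2) (sigmaOf_coord_le _)
  have hsub := condExp_sub hGi hφi m
  have hself : ν[fun x : ℤ → α => φ (word x k 0) | m] = fun x => φ (word x k 0) :=
    condExp_of_stronglyMeasurable hmle hφm hφi
  have hbound : ∀ᵐ x ∂ν, |(ν[(fun x => G (pastOf x)) - (fun x : ℤ → α => φ (word x k 0)) | m]) x| ≤ ε :=
    ae_bdd_abs_condExp_of_ae_bdd_abs (Eventually.of_forall hGk)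
  filter_upwards [hG, htower, hsub, hbound] with x h1 h2 h3 h4
  rw [h3, Pi.sub_apply, h2, hself] at h4
  have h5 := hGk x
  rw [h1] at h5
  have := abs_sub_le (pastMean ν g x) (φ (word x k 0)) (recentMean ν g n x)
  rw [abs_sub_comm (φ (word x k 0))] at this
  rw [meanGap]
  linarith

/-- Almost surely every word of length `k` seen at a late time has occurred often before. -/
lemma ae_eventually_le_card_matchTimes [Nonempty α] (hT : Ergodic shift ν) (k : ℕ) :
    ∀ᵐ x ∂ν, ∀ᶠ n in atTop, J n ≤ (matchTimes x k n).card := by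
  classical
  have hmp := hT.toMeasurePreserving
  set A : (Fin k → α) → Set (ℤ → α) := fun w => {x | word x k 0 = w} with hA
  have hAm : ∀ w, MeasurableSet (A w) := fun w => measurable_word k 0 (measurableSet_singleton w)
  have hJ : Tendsto (fun n : ℕ => (J n : ℝ) / n) atTop (𝓝 0) := by
    refine squeeze_zero (fun n => by positivity) (fun n => ?_) (tendsto_rare_visits (α := α))
    refine div_le_div_of_nonneg_right ?_ (Nat.cast_nonneg n)
    have hc : (1 : ℝ) ≤ (Fintype.card α : ℝ) ^ K α n := by
      refine one_le_pow₀ ?_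
      have : 1 ≤ Fintype.card α := Fintype.card_pos
      exact_mod_cast this
    have hK := Nat.cast_nonneg (α := ℝ) (K α n)
    have hJ0 := Nat.cast_nonneg (α := ℝ) (J n)
    have h1 : (J n : ℝ) ≤ (Fintype.card α : ℝ) ^ K α n * J n + K α n := by nlinarith
    refine h1.trans (le_mul_of_one_le_left (by positivity) ?_)
    push_cast
    linarith
  have hw : ∀ w, ∀ᵐ x ∂ν, ∀ᶠ n : ℕ in atTop, word x k n = w → J n ≤ (matchTimes x k n).card := by
    intro w
    -- A word of probability 0 almost surely never appears along the orbit, so the claim is vacuous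
    -- for it.
    rcases eq_or_lt_of_le (measureReal_nonneg (μ := ν) (s := A w)) with h0 | hpos
    · have h1 : ∀ᵐ x ∂ν, x ∉ A w := by
        rw [← measure_eq_zero_iff_ae_notMem]
        exact (measureReal_eq_zero_iff).1 h0.symm
      filter_upwards [ae_all_shift hmp h1] with x hx
      refine Eventually.of_forall fun n hn => absurd ?_ (hx n)
      show word (shift^[n] x) k 0 = w
      rw [word_shift_iterate, zero_add, hn]
    · set p := ν.real (A w) with hp
      -- The upper ergodic theorem for minus the indicator gives a lower bound of p n / 2 visits.
      -- One quarter of p n pays for J_n, another for the k early visits that are not admissible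
      -- matches.
      have hneg := ae_avgLE hT (f := fun x => -(A w).indicator (1 : (ℤ → α) → ℝ) x)
        (measurable_one.indicator (hAm w)).neg ((integrable_const (1 : ℝ)).indicator (hAm w)).neg
      rw [integral_neg, integral_indicator_one (hAm w), ← hp] at hneg
      filter_upwards [hneg] with x hx
      filter_upwards [hx (-(p / 2)) (by linarith),
        hJ.eventually (gt_mem_nhds (show 0 < p / 4 by positivity)),
        eventually_mul_add_le (show p / 4 < p / 2 by linarith) k, eventually_ge_atTop 1]
        with n h1 h2 h3 hn1 hwn
      have hn0 : (0 : ℝ) < n := by exact_mod_cast hn1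
      rw [div_lt_iff₀ hn0] at h2
      have hcount : (∑ s ∈ Finset.range n, (A w).indicator (1 : (ℤ → α) → ℝ) (shift^[s] x)) ≤
          (matchTimes x k n).card + k := by
        have e : (∑ s ∈ Finset.range n, (A w).indicator (1 : (ℤ → α) → ℝ) (shift^[s] x)) =
            (({s ∈ Finset.range n | word x k (s : ℕ) = w} : Finset ℕ).card : ℝ) := by
          rw [Finset.card_filter, Nat.cast_sum]
          refine Finset.sum_congr rfl fun s _ => ?_
          have : shift^[s] x ∈ A w ↔ word x k (s : ℕ) = w := by
            show word (shift^[s] x) k 0 = w ↔ _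
            rw [word_shift_iterate, zero_add]
          by_cases h : word x k (s : ℕ) = w
          · rw [Set.indicator_of_mem (this.2 h), if_pos h]; simp
          · rw [Set.indicator_of_notMem (fun h' => h (this.1 h')), if_neg h]; simp
        rw [e]
        have hsub : ({s ∈ Finset.range n | word x k (s : ℕ) = w} : Finset ℕ) ⊆
            matchTimes x k n ∪ Finset.range k := by
          intro s hs
          simp only [matchTimes, Finset.mem_union, Finset.mem_filter, Finset.mem_range] at hs ⊢
          by_cases h : k ≤ s + 1
          · exact Or.inl ⟨hs.1, h, hs.2.trans hwn.symm⟩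
          · right; omega
        have := (Finset.card_le_card hsub).trans (Finset.card_union_le _ _)
        rw [Finset.card_range] at this
        exact_mod_cast this
      rw [Finset.sum_neg_distrib] at h1
      have : (J n : ℝ) ≤ (matchTimes x k n).card := by linarith
      exact_mod_cast this
  filter_upwards [ae_all_iff.2 hw] with x hx
  filter_upwards [eventually_all.2 hx] with n hn
  exact hn _ rfl

lemma ae_eventually_min_le_kappa [Nonempty α] (hT : Ergodic shift ν) :
    ∀ᵐ x ∂ν, ∀ k, ∀ᶠ n in atTop, 0 < kappa x n ∧ min k (K α n) ≤ kappa x n := by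
  filter_upwards [ae_all_iff.2 fun k => ae_eventually_le_card_matchTimes (ν := ν) hT k] with x hx k
  have : ∀ᶠ n in atTop, ∀ l ∈ Finset.range (k + 2), J n ≤ (matchTimes x l n).card :=
    (Finset.range (k + 2)).eventually_all.2 fun l _ => hx l
  filter_upwards [this] with n hn
  have hK := one_le_K (α := α) n
  -- Using k + 1 keeps the minimum positive even for k = 0, which gives `kappa` > 0.
  have h : min (k + 1) (K α n) ≤ kappa x n :=
    le_kappa x (by omega) (min_le_right _ _) (hn _ (Finset.mem_range.2 (by omega)))
  omega

/-- The context length may stay below K_n: `deviationSet` covers all admissible lengths, and uniform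
continuity needs only k matching letters. The error is at most ε from deviation, ε from oscillation
and 2ε from the finite past. -/
lemma ae_tendsto_error_of_continuous [Nonempty α] (hT : Ergodic shift ν) (g : α → ℝ)
    {G : (ℕ → α) → ℝ} (hGp : (fun x => G (pastOf x)) =ᵐ[ν] pastMean ν g)
    (hG : ∀ x, ∀ ε > 0, ∃ δ > 0, ∀ y, dStar x y < δ → |G y - G x| < ε) :
    ∀ᵐ x ∂ν, Tendsto (fun n => |estimator g x n - recentMean ν g n (shift^[n] x)|) atTop (𝓝 0) := by
  have hmp := hT.toMeasurePreserving
  have key : ∀ j : ℕ, ∀ᵐ x ∂ν, ∀ᶠ n in atTop,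
      |estimator g x n - recentMean ν g n (shift^[n] x)| ≤ 4 * (1 / ((j : ℝ) + 1)) := by
    intro j
    set ε : ℝ := 1 / ((j : ℝ) + 1) with hε
    have hε0 : 0 < ε := by positivity
    obtain ⟨k, hk⟩ := exists_uniform_agree hG hε0
    have hgap : ∀ᵐ x ∂ν, ∀ n, k ≤ n → meanGap ν g n x ≤ 2 * ε :=
      ae_all_iff.2 fun n => by
        by_cases hn : k ≤ n
        · filter_upwards [ae_meanGap_le_of_agree g hGp hk hn] with x hx _ using hx
        · exact Eventually.of_forall fun x h => absurd h hn
    filter_upwards [ae_all_shift hmp hgap, ae_all_shift hmp hGp, ae_eventually_min_le_kappa hT,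
      ae_eventually_notMem_deviationSet hmp g hε0] with x h1 h2 h3 h4
    filter_upwards [h3 k, h4, eventually_word_eq (α := α) k, eventually_ge_atTop k]
      with n hκ hdevn hword hnk
    obtain ⟨hκ0, hκk⟩ := hκ
    obtain ⟨hκK, hJ⟩ := kappa_spec x hκ0
    rw [estimator_eq g x hκ0]
    set S := matchTimes x (kappa x n) n with hS
    have hc : (0 : ℝ) < S.card := by exact_mod_cast (one_le_J n).trans hJ
    have hdev : |∑ s ∈ S, (g (x ((s : ℤ) + 1)) - pastMean ν g (shift^[s] x))| ≤ ε * S.card := by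
      by_contra hlt
      exact hdevn ⟨kappa x n, hκK, by exact_mod_cast hJ, not_le.1 hlt⟩
    have hosc : ∀ s ∈ S, |pastMean ν g (shift^[s] x) - pastMean ν g (shift^[n] x)| ≤ ε := by
      intro s hs
      rw [← h2 s, ← h2 n]
      simp only [hS, matchTimes, Finset.mem_filter] at hs
      exact hk _ _ (pastOf_agree (hword x _ _ _ hκk hs.2.2))
    have hmain : |∑ s ∈ S, g (x ((s : ℤ) + 1)) - S.card * pastMean ν g (shift^[n] x)| ≤
        2 * ε * S.card := by
      have e : ∑ s ∈ S, g (x ((s : ℤ) + 1)) - S.card * pastMean ν g (shift^[n] x) =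
          ∑ s ∈ S, (g (x ((s : ℤ) + 1)) - pastMean ν g (shift^[s] x)) +
          ∑ s ∈ S, (pastMean ν g (shift^[s] x) - pastMean ν g (shift^[n] x)) := by
        rw [← Finset.sum_add_distrib, Finset.sum_congr rfl
          (fun (s : ℕ) _ => sub_add_sub_cancel (g (x ((s : ℤ) + 1))) (pastMean ν g (shift^[s] x))
            (pastMean ν g (shift^[n] x))), Finset.sum_sub_distrib, Finset.sum_const, nsmul_eq_mul]
      rw [e]
      refine (abs_add_le _ _).trans ?_
      have : |∑ s ∈ S, (pastMean ν g (shift^[s] x) - pastMean ν g (shift^[n] x))| ≤ S.card * ε := by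
        refine (Finset.abs_sum_le_sum_abs _ _).trans ((Finset.sum_le_sum hosc).trans ?_)
        simp
      linarith
    have havg : |1 / (S.card : ℝ) * ∑ s ∈ S, g (x ((s : ℤ) + 1)) -
        pastMean ν g (shift^[n] x)| ≤ 2 * ε := by
      have e : 1 / (S.card : ℝ) * ∑ s ∈ S, g (x ((s : ℤ) + 1)) - pastMean ν g (shift^[n] x) =
          (∑ s ∈ S, g (x ((s : ℤ) + 1)) - S.card * pastMean ν g (shift^[n] x)) / S.card := by
        field_simp
      rw [e, abs_div, abs_of_pos hc, div_le_iff₀ hc]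
      exact hmain
    have t1 := abs_sub_le (1 / (S.card : ℝ) * ∑ s ∈ S, g (x ((s : ℤ) + 1)))
      (pastMean ν g (shift^[n] x)) (recentMean ν g n (shift^[n] x))
    have t2 := h1 n n hnk
    rw [meanGap] at t2
    linarith
  filter_upwards [ae_all_iff.2 key] with x hx
  rw [Metric.tendsto_atTop']
  intro δ hδ
  obtain ⟨j, hj⟩ := exists_nat_one_div_lt (show 0 < δ / 4 by positivity)
  obtain ⟨M, hM⟩ := eventually_atTop.1 (hx j)
  refine ⟨M, fun n hn => ?_⟩
  rw [Real.dist_eq, sub_zero, abs_abs]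
  have := hM n hn.le
  linarith

end Continuity

/-! ### From the coordinate process back to the given series -/

section Transfer

lemma measurable_path {Ω α : Type*} [MeasurableSpace Ω] [MeasurableSpace α] {X : ℤ → Ω → α}
    (hX : ∀ i, Measurable (X i)) : Measurable (path X) :=
  measurable_pi_lambda _ hX

variable {Ω α : Type*} [MeasurableSpace Ω] {μ : Measure Ω} [IsProbabilityMeasure μ]
  [Fintype α] [MeasurableSpace α] [MeasurableSingletonClass α] {X : ℤ → Ω → α}

lemma ae_error_eq_path (hX : IsStationaryErgodic μ X) (g : α → ℝ) :
    ∀ᵐ ω ∂μ, ∀ n, error μ X g n ω = |estimator g (path X ω) n -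
      recentMean (μ.map (path X)) g n (shift^[n] (path X ω))| := by
  have hm := measurable_path hX.1
  have : IsProbabilityMeasure (μ.map (path X)) := Measure.isProbabilityMeasure_map hm.aemeasurable
  have h1 := ae_of_ae_map hm.aemeasurable (ae_error_eq g hX.2.toMeasurePreserving)
  have h2 : ∀ n : ℕ, ∀ᵐ ω ∂μ, error μ X g n ω = error (μ.map (path X)) coord g n (path X ω) := by
    intro n
    have h := condExp_comp_comap (μ := μ) hm (sigmaOf_coord_le (α := α) (Set.Icc 0 (n : ℤ)))
      (f := fun x => g (x ((n : ℤ) + 1))) (integrable_comp_coord g _)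
    rw [comap_path_sigmaOf] at h
    filter_upwards [h] with ω hω
    simp only [error, path_coord]
    simp only [path] at hω ⊢
    rw [hω]
    rfl
  filter_upwards [h1, ae_all_iff.2 h2] with ω a b n
  rw [b n, a n]

/-- Measurability of G makes the set of agreement measurable, so the almost sure identity can pass
to the image law. -/
lemma ae_pastOf_eq_pastMean (hX : IsStationaryErgodic μ X) (g : α → ℝ) {G : (ℕ → α) → ℝ}
    (hGm : Measurable G) (hG : (fun ω => G fun i => X (-(i : ℤ)) ω) =ᵐ[μ]
      μ[fun ω => g (X 1 ω) | sigmaOf X (Set.Iic 0)]) :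
    (fun x => G (pastOf x)) =ᵐ[μ.map (path X)] pastMean (μ.map (path X)) g := by
  have hm := measurable_path hX.1
  have : IsProbabilityMeasure (μ.map (path X)) := Measure.isProbabilityMeasure_map hm.aemeasurable
  have h := condExp_comp_comap (μ := μ) hm (sigmaOf_coord_le (α := α) (Set.Iic 0))
      (f := fun x => g (x 1)) (integrable_comp_coord g _)
  rw [comap_path_sigmaOf] at h
  have hp : Measurable fun x : ℤ → α => pastOf x :=
    measurable_pi_lambda _ fun i => measurable_pi_apply _
  refine (ae_map_iff hm.aemeasurable
    (measurableSet_eq_fun (hGm.comp hp) (measurable_pastMean g))).2 ?_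
  exact hG.trans h

end Transfer

end Forecast

/-! ### The main theorem -/

open Forecast in
theorem mainTheorem1 {Ω α : Type*} [MeasurableSpace Ω] (μ : Measure Ω) [IsProbabilityMeasure μ]
    [Fintype α] [MeasurableSpace α] [MeasurableSingletonClass α]
    (X : ℤ → Ω → α) (hX : Forecast.IsStationaryErgodic μ X) (g : α → ℝ) :
    (Forecast.HasContinuousVersion μ X g →
      ∀ᵐ ω ∂μ, Tendsto (fun n : ℕ => Forecast.error μ X g n ω) atTop (𝓝 0)) ∧
    (∀ᵐ ω ∂μ, Tendsto
      (fun n : ℕ => (1 / (n : ℝ)) * ∑ i ∈ Finset.range n, Forecast.error μ X g i ω)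
      atTop (𝓝 0)) ∧
    (∀ ε : ℝ, 0 < ε →
      Tendsto (fun n : ℕ => μ {ω | ε < Forecast.error μ X g n ω}) atTop (𝓝 0)) := by
  have hm := measurable_path hX.1
  have : IsProbabilityMeasure (μ.map (path X)) := Measure.isProbabilityMeasure_map hm.aemeasurable
  have hT : Ergodic shift (μ.map (path X)) := hX.2
  have : Nonempty α := by
    obtain ⟨ω⟩ := μ.nonempty_of_neZero
    exact ⟨X 0 ω⟩
  have herr := ae_error_eq_path hX g
  refine ⟨?_, ?_, ?_⟩
  · rintro ⟨G, hGp, hG⟩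
    have h := ae_of_ae_map hm.aemeasurable (ae_tendsto_error_of_continuous hT g
      (ae_pastOf_eq_pastMean hX g (measurable_of_dStar_continuous hG) hGp) hG)
    filter_upwards [herr, h] with ω h1 h2
    simpa only [h1] using h2
  · have h := ae_of_ae_map hm.aemeasurable (ae_avgLE_error g hT)
    filter_upwards [herr, h] with ω h1 h2
    simp only [h1]
    exact h2.tendsto fun m => abs_nonneg _
  · intro ε hε
    have h := tendsto_measureReal_error g hT.toMeasurePreserving (show 0 < ε / 4 by positivity)
    have h' := ENNReal.tendsto_ofReal h
    rw [ENNReal.ofReal_zero] at h'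
    refine tendsto_of_tendsto_of_tendsto_of_le_of_le tendsto_const_nhds h' (fun n => zero_le) ?_
    intro n
    beta_reduce
    rw [ofReal_measureReal]
    -- The inequality between a measure and its image holds for every set, so no measurability of
    -- the error event is needed.
    refine le_trans (measure_mono_ae ?_) (Measure.le_map_apply hm.aemeasurable _)
    filter_upwards [herr] with ω hω hlt
    have hlt' : ε < error μ X g n ω := hlt
    rw [hω n] at hlt'
    show 4 * (ε / 4) < _
    linarith
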